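/- **Setting.** Let $(A_t,B_t,U_t,V_t)_{t\ge1}$ be i.i.d. real random vectors with $U_t\le V_t$ a.s. such that for some real $p\ge 2$: $\mathbb E|A_t|^p<1$ and $\mathbb E|B_t|^p+\mathbb E|U_t|^p+\mathbb E|V_t|^p<\infty$. Given an initial action $P_0$, independent of these vectors, in each period $t\ge1$ a decision maker observes the feasible interval $I_t=[A_tP_{t-1}+B_t+U_t,\;A_tP_{t-1}+B_t+V_t]$ and chooses $P_t$. A policy is a sequence of (possibly randomized) rules giving the law of $P_t$ as a function of all past actions and intervals and of $I_t$; it is admissible if $P_t\in I_t$ a.s. for all $t$. A probability measure $\psi$ on $\mathbb R$ is stationary for an admissible policy if, when $P_0\sim\psi$, every $P_t$ has law $\psi$; the variance of $\psi$ is then the stationary variance. The long-run variance of a policy started at $P_0$ is $\inf_{c\in\mathbb R}\limsup_{T\to\infty}\frac1T\sum_{t=1}^T\mathbb E[(P_t-c)^2]$. Write $\Pi_{[l,r]}(z)=\min(\max(z,l),r)$; the anchoring rule with target $z$ is $P_t=\Pi_{I_t}(z)$. For $c\in\mathbb R$, let $I(x)=[Ax+B+U,Ax+B+V]$ with $(A,B,U,V)$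 distributed as one period's vector; a relative value function for center $c$ is a convex $h:\mathbb R\to\mathbb R$ with $|h(x)|\le K(1+x^2)$ for some $K$, satisfying, for some constant $\lambda$, $\lambda+h(x)=\mathbb E\big[\min_{y\in I(x)}\{(y-c)^2+h(y)\}\big]$ for all $x$. Call $z$ an *optimal target* if the anchoring rule with target $z$ has a stationary distribution whose variance is minimal among all stationary distributions of all admissible policies, and $z$ minimizes $(y-c)^2+h(y)$ over all $y\in\mathbb R$ (that is, with the current constraint removed), where $c$ is the mean of that stationary distribution and $h$ some relative value function for center $c$. **Theorem.** (1) There exists an optimal target $z\in\mathbb R$. It can be chosen such that: its anchoring rule has exactly one stationary distribution $\psi$, and $\psi$ has finite second moment and the least stationary variance among all admissible policies; from every initial law with finite second moment this rule has long-run variance $\operatorname{Var}(\psi)$, and every policy admissible from that law has long-run variance at least $\operatorname{Var}(\psi)$; and, moreover, (2) below holds for this $z$ and $\psi$. (2) Suppose in addition that the environment is non-degenerate: for every $x\in\mathbb R$, with positive probability $A_t\ne1$ and $x$ does not lie in the open interval $(A_tx+B_t+U_t,\;A_tx+B_t+V_t)$. Then the optimal policy and the optimal target are unique: if an admissible policy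 has a stationary distribution $\psi'$ with least stationary variance, then $\psi'=\psi$ and, started from $\psi$, $P_t=\Pi_{I_t}(z)$ a.s. for all $t\ge1$; and $z$ is the only optimal target. (3) Under endogenous constraints the target need not equal the long-run mean: there is a non-degenerate environment as above, with $A_t$ not a.s. zero, in which no $z$ whose anchoring rule has least stationary variance is equal to the mean of the corresponding stationary distribution. -/

import Mathlib

open MeasureTheory ProbabilityTheory Filter
open scoped ENNReal

noncomputable section

namespace FeasibleInterval

/-- One period's exogenous randomness `(A, B, U, V)`: persistence, drift, and the endpoints of the
base interval `[U, V]`. -/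
abbrev Shock : Type := ℝ × ℝ × ℝ × ℝ

abbrev Shock.A (e : Shock) : ℝ := e.1
abbrev Shock.B (e : Shock) : ℝ := e.2.1
abbrev Shock.U (e : Shock) : ℝ := e.2.2.1
abbrev Shock.V (e : Shock) : ℝ := e.2.2.2

/-- The feasible interval `A p + B + [U, V]` after the previous action `p`, as the pair of its
endpoints. -/
def Shock.interval (e : Shock) (p : ℝ) : ℝ × ℝ :=
  (e.A * p + e.B + e.U, e.A * p + e.B + e.V)

/-- The transition dynamics: the joint law of `(A, B, U, V)`. Shocks of different periods are
i.i.d. with this law; dependence inside a period is allowed. -/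
structure Environment where
  law : Measure Shock
  isProb : IsProbabilityMeasure law
  base_nonempty : ∀ᵐ e ∂law, e.U ≤ e.V

attribute [instance] Environment.isProb

/-- `L^p`-stability: `E|A|^p < 1` and `E|B|^p + E|U|^p + E|V|^p < ∞`. -/
structure Environment.Stable (E : Environment) (p : ℝ) : Prop where
  two_le : 2 ≤ p
  integrable_A : Integrable (fun e : Shock => |e.A| ^ p) E.law
  integral_A_lt_one : ∫ e, |e.A| ^ p ∂E.law < 1
  integrable_B : Integrable (fun e : Shock => |e.B| ^ p) E.law
  integrable_U : Integrable (fun e : Shock => |e.U| ^ p) E.law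
  integrable_V : Integrable (fun e : Shock => |e.V| ^ p) E.law

/-- Non-degeneracy: for every `z`, with positive probability `A ≠ 1` and the feasible interval
following the action `z` does not contain `z` in its interior. -/
def Environment.Nondegenerate (E : Environment) : Prop :=
  ∀ z : ℝ, 0 < E.law {e | e.A ≠ 1 ∧ ¬ ((e.interval z).1 < z ∧ z < (e.interval z).2)}

/-- What is recorded in one period: the feasible interval and the chosen action. -/
abbrev Obs : Type := (ℝ × ℝ) × ℝ

/-- The observations of periods `0, …, n`. -/
abbrev History (n : ℕ) : Type := (_ : Finset.Iic n) → Obs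

/-- The action of the latest period of a history. -/
def History.lastAction {n : ℕ} (h : History n) : ℝ := (h ⟨n, Finset.mem_Iic.2 le_rfl⟩).2

/-- A history-dependent randomized policy: `rule n` gives the law of the action of period `n + 1`
from all past intervals and actions and the current interval. -/
structure Policy where
  rule : (n : ℕ) → Kernel (History n × (ℝ × ℝ)) ℝ
  isMarkov : ∀ n, IsMarkovKernel (rule n)

attribute [instance] Policy.isMarkov

theorem measurable_interval_lastAction (n : ℕ) :
    Measurable (fun q : History n × Shock => q.2.interval q.1.lastAction) := by
  unfold Shock.interval History.lastAction
  fun_prop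

/-- Conditional law of the next feasible interval, given the history. -/
def intervalKernel (E : Environment) (n : ℕ) : Kernel (History n) (ℝ × ℝ) :=
  (Kernel.id ×ₖ Kernel.const (History n) E.law).map
    (fun q : History n × Shock => q.2.interval q.1.lastAction)

instance (E : Environment) (n : ℕ) : IsMarkovKernel (intervalKernel E n) :=
  Kernel.IsMarkovKernel.map _ (measurable_interval_lastAction n)

/-- One period: the interval is realized, then the policy draws the action. -/
def stepKernel (E : Environment) (π : Policy) (n : ℕ) : Kernel (History n) Obs :=
  intervalKernel E n ⊗ₖ π.rule n

instance (E : Environment) (π : Policy) (n : ℕ) : IsMarkovKernel (stepKernel E π n) := by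
  unfold stepKernel; infer_instance

/-- The law of the whole path `((I_t, P_t))_{t ≥ 0}` under `π` when `P_0` has law `ρ`. Period `0`
has no constraint; its interval entry is the dummy value `{P_0}`. -/
def pathLaw (E : Environment) (π : Policy) (ρ : Measure ℝ) : Measure (ℕ → Obs) :=
  (ρ.map (fun p : ℝ => (fun _ => ((p, p), p) : History 0))).bind
    (Kernel.traj (X := fun _ => Obs) (stepKernel E π) 0)

/-- The policy respects the feasibility constraints almost surely when `P_0` has law `ρ`. -/
def Admissible (E : Environment) (π : Policy) (ρ : Measure ℝ) : Prop :=
  ∀ t : ℕ, ∀ᵐ x ∂pathLaw E π ρ, (x (t + 1)).2 ∈ Set.Icc (x (t + 1)).1.1 (x (t + 1)).1.2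

/-- `ψ` is a stationary distribution of the action under the admissible policy `π`. -/
structure IsStationary (E : Environment) (π : Policy) (ψ : Measure ℝ) : Prop where
  isProb : IsProbabilityMeasure ψ
  admissible : Admissible E π ψ
  law_action : ∀ t : ℕ, (pathLaw E π ψ).map (fun x => (x t).2) = ψ

/-- `π`, run in its stationary distribution `ψ`, has minimal stationary variance among all
history-dependent randomized admissible policies. -/
def MinimizesStationaryVariance (E : Environment) (π : Policy) (ψ : Measure ℝ) : Prop :=
  IsStationary E π ψ ∧
    ∀ (π' : Policy) (ψ' : Measure ℝ), IsStationary E π' ψ' → evariance id ψ ≤ evariance id ψ'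

/-- Long-run average squared distance of the actions to `c`. -/
def longRunMSE (E : Environment) (π : Policy) (ρ : Measure ℝ) (c : ℝ) : ℝ≥0∞ :=
  limsup (fun T : ℕ => (∑ t ∈ Finset.range T,
    ∫⁻ x, ENNReal.ofReal (((x (t + 1)).2 - c) ^ 2) ∂pathLaw E π ρ) / (T : ℝ≥0∞)) atTop

/-- Long-run variance of the action path: the long-run mean squared error about the best center. -/
def longRunVariance (E : Environment) (π : Policy) (ρ : Measure ℝ) : ℝ≥0∞ :=
  ⨅ c : ℝ, longRunMSE E π ρ c

/-- Projection of `x` onto the interval with endpoints `I.1 ≤ I.2`. -/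
def proj (I : ℝ × ℝ) (x : ℝ) : ℝ := min (max x I.1) I.2

theorem measurable_proj (z : ℝ) (n : ℕ) :
    Measurable (fun q : History n × (ℝ × ℝ) => proj q.2 z) := by
  unfold proj
  fun_prop

/-- The anchoring rule with target `z`: always project `z` onto the current interval. -/
def anchoring (z : ℝ) : Policy where
  rule n := Kernel.deterministic (fun q : History n × (ℝ × ℝ) => proj q.2 z) (measurable_proj z n)
  isMarkov _ := inferInstance

/-- `h` is a relative value function, with average cost `cost`, for the problem of minimizing the
long-run average of `(P_t - c)^2`: it is convex, grows at most quadratically, and solves the average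
cost optimality equation `cost + h x = E [min_{y ∈ I(x)} ((y - c)^2 + h y)]`. -/
structure IsRelativeValue (E : Environment) (c cost : ℝ) (h : ℝ → ℝ) : Prop where
  convex : ConvexOn ℝ Set.univ h
  growth : ∃ K : ℝ, ∀ x, |h x| ≤ K * (1 + x ^ 2)
  integrable : ∀ x, Integrable (fun e : Shock =>
    sInf ((fun y => (y - c) ^ 2 + h y) '' Set.Icc (e.interval x).1 (e.interval x).2)) E.law
  optimality : ∀ x, cost + h x = ∫ e : Shock,
    sInf ((fun y => (y - c) ^ 2 + h y) '' Set.Icc (e.interval x).1 (e.interval x).2) ∂E.law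

/-- `z` is an optimal target for the center `c`: the action that would be chosen if the current
constraint were absent, i.e. a minimizer over `ℝ` of current cost plus relative value. -/
def IsUnconstrainedOptimum (E : Environment) (c z : ℝ) : Prop :=
  ∃ (cost : ℝ) (h : ℝ → ℝ), IsRelativeValue E c cost h ∧
    ∀ y, (z - c) ^ 2 + h z ≤ (y - c) ^ 2 + h y

/-- `z` is an optimal target with stationary distribution `ψ`: the anchoring rule at `z`, run in
`ψ`, minimizes the stationary variance, and `z` is the unconstrained optimum for the mean of `ψ`. -/
def IsOptimalTarget (E : Environment) (z : ℝ) (ψ : Measure ℝ) : Prop :=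
  MinimizesStationaryVariance E (anchoring z) ψ ∧ IsUnconstrainedOptimum E (∫ x, x ∂ψ) z

end FeasibleInterval

end

/-!
# Variance-minimizing policies under a random feasible interval

Only mean-square stability is used: `E A² < 1` and square-integrable `B`, `U`, `V`.

*Optimality equation.* For a fixed center `c`, a relative value function `h` is obtained from its
slope. If `γ s = 2 (s - c) + k s` is the increasing slope of `(s - c)² + h s`, then the minimum of
that function over a moving interval `[l, u]` has slope `max (γ l) (min 0 (γ u))`. The optimality
equation thus becomes a fixed point equation for `k`, and its right-hand side contracts the supremum
norm with weight `1 + ε |x|` (`exists_slope_fixedPoint`). Integrating `k` gives `h`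
(`exists_isRelativeValue`), and the constrained minimum is attained at the projection of the
unconstrained minimizer `z`, by convexity.

*Verification.* `FeasibleStep` records what a single period of any history-dependent randomized
policy provides. The optimality inequality along a step (`FeasibleStep.cost_add_le`), with equality
only for the projection of `z` (`FeasibleStep.ae_eq_proj`), yields the bounds for stationary laws
and, telescoped, for the long-run mean squared error.

*Anchoring rules.* `x ↦ anchor z e x` is `|A|`-Lipschitz. Hence the anchoring rule has exactly one
stationary law, the law of the limit of backward iterates (`stationaryAction`), and the same shocks
couple the rules for all targets.

*Choice of the center.* Variance is the minimum of the mean squared error over centers, so the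
least stationary variance is the minimum of the optimal average cost over `c`. The cost is coercive
and continuous in `c`, and at a minimizing `c` the mean of the stationary law must be `c`
(`exists_optimal_center`).

*Uniqueness.* Given two optimal anchoring rules driven by the same shocks, the midpoint of the two
paths is feasible, because feasibility is jointly convex in consecutive actions. The parallelogram
identity forces the paths to differ by a constant `d`. If `d ≠ 0`, then every shock with `A ≠ 1`
puts the midpoint path in the interior of its interval, hence at its own target, which is therefore
an atom; non-degeneracy at that point is then violated
(`Environment.MeanSquareStable.center_unique`). For a fixed center, two relative value functions
differ by a constant (`IsRelativeValue.target_unique`).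

*Target and mean.* In `reflectionEnv` a target equal to its stationary mean must be `1/3`, with
variance `4/9`, while the target `0` has variance `7/16`.
-/

namespace FeasibleInterval

noncomputable section

open Set
open scoped Topology

/-! ### Second moments and the anchoring rule -/

theorem abs_integral_le_of_ae_abs_le {α : Type*} [MeasurableSpace α] {μ : Measure α} {f g : α → ℝ}
    (hg : Integrable g μ) (h : ∀ᵐ x ∂μ, |f x| ≤ g x) : |∫ x, f x ∂μ| ≤ ∫ x, g x ∂μ :=
  (Real.norm_eq_abs _).symm.trans_le (norm_integral_le_of_norm_le (f := f) hg h)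

/-- A bound for the drift and the base interval of one period. -/
def Shock.noise (e : Shock) : ℝ := |e.B| + |e.U| + |e.V|

/-- The action chosen by the anchoring rule with target `z` after the action `x` when the shock `e`
occurs. -/
def anchor (z : ℝ) (e : Shock) (x : ℝ) : ℝ := proj (e.interval x) z

/-- Square-integrability with a mean-square contraction, the consequence of stability that the
whole argument runs on. -/
structure Environment.MeanSquareStable (E : Environment) : Prop where
  memLp_A : MemLp (fun e : Shock => e.A) 2 E.law
  integral_sq_lt_one : ∫ e, e.A ^ 2 ∂E.law < 1
  memLp_noise : MemLp Shock.noise 2 E.law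

theorem Shock.noise_nonneg (e : Shock) : 0 ≤ e.noise := by
  unfold Shock.noise; positivity

/-- Bernoulli's inequality compares `E|A|²` with `E|A|^p`. -/
theorem Environment.Stable.meanSquareStable {E : Environment} {p : ℝ} (h : E.Stable p) :
    E.MeanSquareStable := by
  have hp := h.two_le
  have key : ∀ t : ℝ, t ^ 2 ≤ 2 / p * |t| ^ p + (1 - 2 / p) := by
    intro t
    have h1 := one_add_mul_self_le_rpow_one_add (s := t ^ 2 - 1) (p := p / 2)
      (by nlinarith [sq_nonneg t]) (by linarith)
    have h2 : (1 + (t ^ 2 - 1)) ^ (p / 2) = |t| ^ p := by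
      rw [← sq_abs, add_sub_cancel, ← Real.rpow_natCast, ← Real.rpow_mul (abs_nonneg t)]
      congr 1
      push_cast
      ring
    rw [h2] at h1
    have : 2 / p * (1 + p / 2 * (t ^ 2 - 1)) ≤ 2 / p * |t| ^ p := by gcongr
    have e : 2 / p * (1 + p / 2 * (t ^ 2 - 1)) = 2 / p + t ^ 2 - 1 := by
      field_simp
      ring
    linarith
  have hL : ∀ f : Shock → ℝ, Measurable f → Integrable (fun e => |f e| ^ p) E.law →
      MemLp f 2 E.law := by
    intro f hf hi
    rw [memLp_two_iff_integrable_sq hf.aestronglyMeasurable]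
    refine ((hi.const_mul (2 / p)).add (integrable_const (1 - 2 / p))).mono'
      (hf.pow_const 2).aestronglyMeasurable (Eventually.of_forall fun e => ?_)
    rw [Real.norm_of_nonneg (sq_nonneg _)]
    exact key _
  have hA := hL (fun e => e.A) (by fun_prop) h.integrable_A
  refine ⟨hA, ?_, ?_⟩
  · calc ∫ e, e.A ^ 2 ∂E.law ≤ ∫ e, (2 / p * |e.A| ^ p + (1 - 2 / p)) ∂E.law :=
          integral_mono hA.integrable_sq ((h.integrable_A.const_mul _).add (integrable_const _))
            fun e => key _
      _ = 2 / p * ∫ e, |e.A| ^ p ∂E.law + (1 - 2 / p) := by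
          rw [integral_add (h.integrable_A.const_mul _) (integrable_const _),
            integral_const_mul]
          simp
      _ < 2 / p * 1 + (1 - 2 / p) := by
          have := h.integral_A_lt_one
          gcongr
      _ = 1 := by ring
  · exact (((hL (fun e => e.B) (by fun_prop) h.integrable_B).abs).add
      ((hL (fun e => e.U) (by fun_prop) h.integrable_U).abs)).add
      ((hL (fun e => e.V) (by fun_prop) h.integrable_V).abs)

section moments

variable {E : Environment} (hE : E.MeanSquareStable)
include hE

theorem Environment.MeanSquareStable.integrable_abs_A :
    Integrable (fun e : Shock => |e.A|) E.law :=
  (hE.memLp_A.integrable one_le_two).abs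

theorem Environment.MeanSquareStable.integrable_abs_A_mul_noise :
    Integrable (fun e : Shock => |e.A| * e.noise) E.law :=
  hE.memLp_A.abs.integrable_mul hE.memLp_noise

theorem Environment.MeanSquareStable.integral_abs_A_lt_one : ∫ e, |e.A| ∂E.law < 1 := by
  have h1 : ∫ e, |e.A| ∂E.law ≤ ∫ e, (1 / 2 + 1 / 2 * e.A ^ 2) ∂E.law := by
    refine integral_mono hE.integrable_abs_A
      ((integrable_const _).add (hE.memLp_A.integrable_sq.const_mul _)) fun e => ?_
    have := sq_nonneg (|e.A| - 1)
    have h2 := sq_abs e.A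
    simp only
    nlinarith
  rw [integral_add (integrable_const _) (hE.memLp_A.integrable_sq.const_mul _),
    integral_const_mul] at h1
  have := hE.integral_sq_lt_one
  simp at h1
  linarith

theorem Environment.MeanSquareStable.integrable_weight (ε s c : ℝ) :
    Integrable (fun e : Shock => |e.A| * (1 + ε * (|e.A| * s + c * e.noise))) E.law := by
  have : (fun e : Shock => |e.A| * (1 + ε * (|e.A| * s + c * e.noise))) = fun e =>
      |e.A| + (ε * s * e.A ^ 2 + ε * c * (|e.A| * e.noise)) := by
    ext e
    rw [← sq_abs e.A]
    ring
  rw [this]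
  exact hE.integrable_abs_A.add ((hE.memLp_A.integrable_sq.const_mul _).add
    (hE.integrable_abs_A_mul_noise.const_mul _))

/-- The weight `1 + ε |x|` for which one period is a contraction, in the sense that
`E[|A| (1 + ε (|A| s + 2 W))] ≤ r (1 + ε s)` with `r < 1`. -/
theorem Environment.MeanSquareStable.exists_weight :
    ∃ ε r : ℝ, 0 < ε ∧ 0 ≤ r ∧ r < 1 ∧ ∀ s, 0 ≤ s →
      ∫ e : Shock, |e.A| * (1 + ε * (|e.A| * s + 2 * e.noise)) ∂E.law ≤ r * (1 + ε * s) := by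
  set m := ∫ e : Shock, |e.A| ∂E.law with hm
  set k := ∫ e : Shock, |e.A| * e.noise ∂E.law with hk
  set a := ∫ e : Shock, e.A ^ 2 ∂E.law with ha
  have hm1 : m < 1 := hE.integral_abs_A_lt_one
  have ha1 : a < 1 := hE.integral_sq_lt_one
  have hm0 : 0 ≤ m := integral_nonneg fun e => abs_nonneg _
  have hk0 : 0 ≤ k := integral_nonneg fun e => mul_nonneg (abs_nonneg _) e.noise_nonneg
  have hδ : 0 < (1 - m) / (4 * (k + 1)) := by
    apply div_pos <;> linarith
  set ε := (1 - m) / (4 * (k + 1)) with hε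
  have hεk : ε * (2 * k) ≤ (1 - m) / 2 := by
    have : ε * (4 * (k + 1)) = 1 - m := by rw [hε]; field_simp
    nlinarith
  refine ⟨ε, max ((1 + m) / 2) a, hδ, le_max_of_le_left (by linarith),
    max_lt (by linarith) ha1, fun s hs => ?_⟩
  have heq : ∫ e : Shock, |e.A| * (1 + ε * (|e.A| * s + 2 * e.noise)) ∂E.law
      = m + (ε * s * a + ε * 2 * k) := by
    rw [hm, ha, hk, ← integral_const_mul, ← integral_const_mul, ← integral_add, ← integral_add]
    · congr 1
      ext e
      rw [← sq_abs e.A]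
      ring
    · exact hE.integrable_abs_A
    · exact (hE.memLp_A.integrable_sq.const_mul _).add (hE.integrable_abs_A_mul_noise.const_mul _)
    · exact hE.memLp_A.integrable_sq.const_mul _
    · exact hE.integrable_abs_A_mul_noise.const_mul _
  rw [heq]
  have h1 : m + ε * 2 * k ≤ max ((1 + m) / 2) a := le_max_of_le_left (by linarith)
  have h2 : ε * s * a ≤ ε * s * max ((1 + m) / 2) a := by
    gcongr
    exact le_max_right _ _
  linarith

theorem Environment.MeanSquareStable.integrable_sq_bound (s : ℝ) :
    Integrable (fun e : Shock => (|e.A| * s + e.noise) ^ 2) E.law :=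
  ((hE.memLp_A.abs.mul_const s).add hE.memLp_noise).integrable_sq

/-- Second moments drift towards a bounded region under every feasible choice. -/
theorem Environment.MeanSquareStable.exists_sq_drift :
    ∃ a C : ℝ, 0 ≤ a ∧ a < 1 ∧ 0 ≤ C ∧ ∀ s : ℝ,
      ∫ e : Shock, (|e.A| * s + e.noise) ^ 2 ∂E.law ≤ a * s ^ 2 + C := by
  set k := ∫ e : Shock, |e.A| * e.noise ∂E.law with hk
  set w := ∫ e : Shock, e.noise ^ 2 ∂E.law with hw
  set a := ∫ e : Shock, e.A ^ 2 ∂E.law with ha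
  have ha1 : a < 1 := hE.integral_sq_lt_one
  have ha0 : 0 ≤ a := integral_nonneg fun e => sq_nonneg _
  have hw0 : 0 ≤ w := integral_nonneg fun e => sq_nonneg _
  refine ⟨(1 + a) / 2, 2 * k ^ 2 / (1 - a) + w, by linarith, by linarith,
    add_nonneg (div_nonneg (by positivity) (by linarith)) hw0, fun s => ?_⟩
  have heq : ∫ e : Shock, (|e.A| * s + e.noise) ^ 2 ∂E.law = s ^ 2 * a + (2 * s * k + w) := by
    rw [hw, ha, hk, ← integral_const_mul, ← integral_const_mul, ← integral_add, ← integral_add]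
    · congr 1
      ext e
      rw [← sq_abs e.A]
      ring
    · exact hE.memLp_A.integrable_sq.const_mul _
    · exact (hE.integrable_abs_A_mul_noise.const_mul _).add hE.memLp_noise.integrable_sq
    · exact hE.integrable_abs_A_mul_noise.const_mul _
    · exact hE.memLp_noise.integrable_sq
  rw [heq]
  have h1 : 2 * s * k ≤ (1 - a) / 2 * s ^ 2 + 2 * k ^ 2 / (1 - a) := by
    have h3 : 0 < 1 - a := by linarith
    rw [← sub_nonneg]
    have : (1 - a) / 2 * s ^ 2 + 2 * k ^ 2 / (1 - a) - 2 * s * k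
        = ((1 - a) * s - 2 * k) ^ 2 / (2 * (1 - a)) := by
      field_simp
      ring
    rw [this]
    positivity
  linarith

end moments

section anchorRule

theorem proj_mem {I : ℝ × ℝ} (h : I.1 ≤ I.2) (z : ℝ) : proj I z ∈ Icc I.1 I.2 :=
  ⟨le_min (le_max_right _ _) h, min_le_right _ _⟩

theorem interval_fst_le_snd {e : Shock} (h : e.U ≤ e.V) (x : ℝ) :
    (e.interval x).1 ≤ (e.interval x).2 := by
  unfold Shock.interval; simpa using h

theorem Environment.ae_interval_le (E : Environment) :
    ∀ᵐ e : Shock ∂E.law, ∀ x, (e.interval x).1 ≤ (e.interval x).2 := by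
  filter_upwards [E.base_nonempty] with e he x using interval_fst_le_snd he x

@[fun_prop]
theorem measurable_interval : Measurable fun q : ℝ × Shock => q.2.interval q.1 := by
  unfold Shock.interval; fun_prop

@[fun_prop]
theorem measurable_interval_left (x : ℝ) : Measurable fun e : Shock => e.interval x := by
  unfold Shock.interval; fun_prop

@[fun_prop]
theorem measurable_proj_left (z : ℝ) : Measurable fun I : ℝ × ℝ => proj I z := by
  unfold proj; fun_prop

@[fun_prop]
theorem measurable_anchor (z : ℝ) : Measurable fun q : ℝ × Shock => anchor z q.2 q.1 :=
  (measurable_proj_left z).comp measurable_interval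

@[fun_prop]
theorem measurable_anchor_left (z x : ℝ) : Measurable fun e : Shock => anchor z e x :=
  (measurable_proj_left z).comp (measurable_interval_left x)

theorem abs_anchor_sub_le (z : ℝ) (e : Shock) (x y : ℝ) :
    |anchor z e x - anchor z e y| ≤ |e.A| * |x - y| := by
  unfold anchor proj Shock.interval
  refine (abs_min_sub_min_le_max _ _ _ _).trans (max_le ?_ ?_)
  · rw [max_comm z, max_comm z]
    refine (abs_max_sub_max_le_abs _ _ _).trans (le_of_eq ?_)
    rw [← abs_mul]
    congr 1
    simp only
    ring
  · rw [← abs_mul]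
    refine le_of_eq (congrArg _ ?_)
    simp only
    ring

/-- A bound for all actions that are feasible after `x`. -/
theorem abs_le_of_mem_interval {e : Shock} {x y : ℝ}
    (hy : y ∈ Icc (e.interval x).1 (e.interval x).2) : |y| ≤ |e.A| * |x| + e.noise := by
  obtain ⟨h1, h2⟩ := hy
  unfold Shock.interval at h1 h2
  unfold Shock.noise
  simp only at h1 h2
  rw [← abs_mul]
  rw [abs_le]
  constructor
  · linarith [neg_abs_le (e.A * x), neg_abs_le e.B, neg_abs_le e.U, abs_nonneg e.V]
  · linarith [le_abs_self (e.A * x), le_abs_self e.B, le_abs_self e.V, abs_nonneg e.U]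

theorem abs_anchor_le {e : Shock} (he : e.U ≤ e.V) (z x : ℝ) :
    |anchor z e x| ≤ |e.A| * |x| + e.noise :=
  abs_le_of_mem_interval (proj_mem (interval_fst_le_snd he x) z)

end anchorRule

/-! ### Projections, relative value functions and one feasible period -/

section convexMinimization

variable {g : ℝ → ℝ} {z : ℝ} {I : ℝ × ℝ}

theorem proj_eq_left (hI : I.1 ≤ I.2) (h : z ≤ I.1) : proj I z = I.1 := by
  unfold proj; rw [max_eq_right h, min_eq_left hI]

theorem proj_eq_right (hI : I.1 ≤ I.2) (h : I.2 ≤ z) : proj I z = I.2 := by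
  unfold proj; rw [max_eq_left (hI.trans h), min_eq_right h]

theorem proj_eq_self (h1 : I.1 ≤ z) (h2 : z ≤ I.2) : proj I z = z := by
  unfold proj; rw [max_eq_left h1, min_eq_left h2]

/-- The projection of `z` lies between `z` and any other point of the interval. -/
theorem proj_mem_segment {y : ℝ} (hy : y ∈ Icc I.1 I.2) : proj I z ∈ segment ℝ z y := by
  have hI := hy.1.trans hy.2
  rcases le_total z I.1 with h1 | h1
  · rw [proj_eq_left hI h1, segment_eq_Icc (h1.trans hy.1)]
    exact ⟨h1, hy.1⟩
  · rcases le_total z I.2 with h2 | h2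
    · rw [proj_eq_self h1 h2]
      exact left_mem_segment ℝ _ _
    · rw [proj_eq_right hI h2, segment_symm, segment_eq_Icc (hy.2.trans h2)]
      exact ⟨hy.2, h2⟩

theorem apply_proj_le (hg : ConvexOn ℝ univ g) (hz : ∀ y, g z ≤ g y) {y : ℝ}
    (hy : y ∈ Icc I.1 I.2) : g (proj I z) ≤ g y :=
  (hg.le_on_segment (mem_univ _) (mem_univ _) (proj_mem_segment hy)).trans
    (max_le (hz y) le_rfl)

theorem eq_proj_of_apply_le (hg : StrictConvexOn ℝ univ g) (hz : ∀ y, g z ≤ g y) {y : ℝ}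
    (hy : y ∈ Icc I.1 I.2) (h : g y ≤ g (proj I z)) : y = proj I z := by
  by_contra hne
  have hle := apply_proj_le hg.convexOn hz hy
  have hmid : (1 / 2 : ℝ) • y + (1 / 2 : ℝ) • proj I z ∈ Icc I.1 I.2 :=
    (convex_Icc _ _) hy (proj_mem (hy.1.trans hy.2) z) (by norm_num) (by norm_num) (by norm_num)
  have h1 : g ((1 / 2 : ℝ) • y + (1 / 2 : ℝ) • proj I z) <
      (1 / 2 : ℝ) • g y + (1 / 2 : ℝ) • g (proj I z) :=
    hg.2 (mem_univ y) (mem_univ _) hne (by norm_num) (by norm_num) (by norm_num)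
  have h2 := apply_proj_le hg.convexOn hz hmid
  simp only [smul_eq_mul] at h1 h2
  linarith

theorem sInf_image_Icc_eq (hg : ConvexOn ℝ univ g) (hz : ∀ y, g z ≤ g y) (hI : I.1 ≤ I.2) :
    sInf (g '' Icc I.1 I.2) = g (proj I z) := by
  refine IsLeast.csInf_eq ⟨mem_image_of_mem _ (proj_mem hI z), ?_⟩
  rintro _ ⟨y, hy, rfl⟩
  exact apply_proj_le hg hz hy

theorem strictConvexOn_sq_sub_add (c : ℝ) {h : ℝ → ℝ} (hh : ConvexOn ℝ univ h) :
    StrictConvexOn ℝ univ fun y => (y - c) ^ 2 + h y := by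
  have h1 : StrictConvexOn ℝ univ fun y : ℝ => (y - c) ^ 2 := by
    refine ⟨convex_univ, fun x _ y _ hxy a b ha hb hab => ?_⟩
    have hb' : b = 1 - a := by linarith
    subst hb'
    have : 0 < a * (1 - a) * (x - y) ^ 2 := by
      have := sub_ne_zero.2 hxy
      positivity
    simp only [smul_eq_mul]
    nlinarith
  exact h1.add_convexOn hh

end convexMinimization

theorem integrable_comp_of_quadratic_growth {Ω : Type*} [MeasurableSpace Ω] {μ : Measure Ω}
    [IsFiniteMeasure μ] {P : Ω → ℝ} (hP : MemLp P 2 μ) {f : ℝ → ℝ}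
    (hf : Continuous f) {K : ℝ} (hK : ∀ x, |f x| ≤ K * (1 + x ^ 2)) :
    Integrable (fun ω => f (P ω)) μ := by
  refine (((integrable_const 1).add hP.integrable_sq).const_mul K).mono'
    (hf.comp_aestronglyMeasurable hP.1) (Eventually.of_forall fun ω => ?_)
  simpa using hK (P ω)

section relativeValue

variable {E : Environment} {c cost z : ℝ} {h : ℝ → ℝ}

theorem IsRelativeValue.continuous (H : IsRelativeValue E c cost h) : Continuous h := by
  rw [← continuousOn_univ]
  exact H.convex.continuousOn isOpen_univ

theorem IsRelativeValue.continuous_total (H : IsRelativeValue E c cost h) :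
    Continuous fun y => (y - c) ^ 2 + h y := by
  have := H.continuous
  fun_prop

theorem quadratic_growth_sq_sub_add (c : ℝ) {h : ℝ → ℝ} {K : ℝ}
    (hK : ∀ x, |h x| ≤ K * (1 + x ^ 2)) : ∃ K', ∀ y, |(y - c) ^ 2 + h y| ≤ K' * (1 + y ^ 2) := by
  refine ⟨2 + 2 * c ^ 2 + K, fun y => ?_⟩
  have h1 : (y - c) ^ 2 ≤ (2 + 2 * c ^ 2) * (1 + y ^ 2) := by
    nlinarith [sq_nonneg (y + c), sq_nonneg y, sq_nonneg c, mul_nonneg (sq_nonneg y) (sq_nonneg c)]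
  calc |(y - c) ^ 2 + h y| ≤ |(y - c) ^ 2| + |h y| := abs_add_le _ _
    _ ≤ (2 + 2 * c ^ 2) * (1 + y ^ 2) + K * (1 + y ^ 2) := by
      rw [abs_of_nonneg (sq_nonneg _)]; exact add_le_add h1 (hK y)
    _ = _ := by ring

theorem IsRelativeValue.growth_total (H : IsRelativeValue E c cost h) :
    ∃ K, ∀ y, |(y - c) ^ 2 + h y| ≤ K * (1 + y ^ 2) := by
  obtain ⟨K, hK⟩ := H.growth
  exact quadratic_growth_sq_sub_add c hK

/-- The optimality equation with its minimum written out: projecting the unconstrained minimizer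
is optimal. -/
theorem IsRelativeValue.bellman (H : IsRelativeValue E c cost h)
    (hz : ∀ y, (z - c) ^ 2 + h z ≤ (y - c) ^ 2 + h y) (x : ℝ) :
    cost + h x = ∫ e : Shock, ((anchor z e x - c) ^ 2 + h (anchor z e x)) ∂E.law := by
  rw [H.optimality x]
  refine integral_congr_ae ?_
  filter_upwards [E.ae_interval_le] with e he
  exact sInf_image_Icc_eq (strictConvexOn_sq_sub_add c H.convex).convexOn hz (he x)

end relativeValue

/-- A single period of a controlled path on a probability space: `I` is the feasible interval that
follows the action `P`, driven by a shock independent of `P`, and the next action `P'` lies in `I`.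
Nothing is said about how `P'` is selected, so history dependence and randomization are covered. -/
structure FeasibleStep (E : Environment) {Ω : Type*} [MeasurableSpace Ω] (μ : Measure Ω)
    (P : Ω → ℝ) (I : Ω → ℝ × ℝ) (P' : Ω → ℝ) : Prop where
  measurable_prev : Measurable P
  measurable_interval : Measurable I
  measurable_next : Measurable P'
  map_eq : μ.map (fun ω => (P ω, I ω)) =
    ((μ.map P).prod E.law).map fun q : ℝ × Shock => (q.1, q.2.interval q.1)
  mem : ∀ᵐ ω ∂μ, P' ω ∈ Icc (I ω).1 (I ω).2

namespace FeasibleStep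

variable {E : Environment} {Ω : Type*} [MeasurableSpace Ω] {μ : Measure Ω}
  [IsProbabilityMeasure μ] {P : Ω → ℝ} {I : Ω → ℝ × ℝ} {P' : Ω → ℝ}

theorem lintegral_eq (S : FeasibleStep E μ P I P') {F : ℝ × ℝ × ℝ → ℝ≥0∞} (hF : Measurable F) :
    ∫⁻ ω, F (P ω, I ω) ∂μ = ∫⁻ ω, ∫⁻ e : Shock, F (P ω, e.interval (P ω)) ∂E.law ∂μ := by
  have : IsProbabilityMeasure (μ.map P) :=
    Measure.isProbabilityMeasure_map S.measurable_prev.aemeasurable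
  have hm : Measurable fun q : ℝ × Shock => (q.1, q.2.interval q.1) := by fun_prop
  rw [← lintegral_map hF (S.measurable_prev.prodMk S.measurable_interval), S.map_eq,
    lintegral_map hF hm]
  refine (lintegral_prod _ (hF.comp hm).aemeasurable).trans ?_
  exact lintegral_map ((hF.comp hm).lintegral_prod_right') S.measurable_prev

theorem integral_eq (S : FeasibleStep E μ P I P') {F : ℝ × ℝ × ℝ → ℝ} (hF : Measurable F)
    (hi : Integrable (fun ω => F (P ω, I ω)) μ) :
    ∫ ω, F (P ω, I ω) ∂μ = ∫ ω, ∫ e : Shock, F (P ω, e.interval (P ω)) ∂E.law ∂μ := by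
  have : IsProbabilityMeasure (μ.map P) :=
    Measure.isProbabilityMeasure_map S.measurable_prev.aemeasurable
  have hm : Measurable fun q : ℝ × Shock => (q.1, q.2.interval q.1) := by fun_prop
  have hPI := S.measurable_prev.prodMk S.measurable_interval
  have hi' : Integrable F (μ.map fun ω => (P ω, I ω)) :=
    (integrable_map_measure hF.aestronglyMeasurable hPI.aemeasurable).2 hi
  rw [S.map_eq, integrable_map_measure hF.aestronglyMeasurable hm.aemeasurable] at hi'
  rw [← integral_map hPI.aemeasurable hF.aestronglyMeasurable, S.map_eq,
    integral_map hm.aemeasurable hF.aestronglyMeasurable]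
  refine (integral_prod _ hi').trans ?_
  exact integral_map S.measurable_prev.aemeasurable hi'.integral_prod_left.aestronglyMeasurable

omit [IsProbabilityMeasure μ] in
theorem interval_le (S : FeasibleStep E μ P I P') : ∀ᵐ ω ∂μ, (I ω).1 ≤ (I ω).2 := by
  filter_upwards [S.mem] with ω h using h.1.trans h.2

omit [IsProbabilityMeasure μ] in
theorem project (S : FeasibleStep E μ P I P') (z : ℝ) :
    FeasibleStep E μ P I fun ω => proj (I ω) z where
  measurable_prev := S.measurable_prev
  measurable_interval := S.measurable_interval
  measurable_next := (measurable_proj_left z).comp S.measurable_interval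
  map_eq := S.map_eq
  mem := by filter_upwards [S.interval_le] with ω h using proj_mem h z

theorem lintegral_sq_next_le (S : FeasibleStep E μ P I P') (hE : E.MeanSquareStable) {a C : ℝ}
    (haC : ∀ s : ℝ, ∫ e : Shock, (|e.A| * s + e.noise) ^ 2 ∂E.law ≤ a * s ^ 2 + C) :
    ∫⁻ ω, ENNReal.ofReal (P' ω ^ 2) ∂μ ≤ ∫⁻ ω, ENNReal.ofReal (a * P ω ^ 2 + C) ∂μ := by
  have habs : Measurable fun x : ℝ => |x| := measurable_norm
  have hF : Measurable fun q : ℝ × ℝ × ℝ =>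
      ENNReal.ofReal (max |q.2.1| |q.2.2| ^ 2) :=
    (((habs.comp (by fun_prop)).max (habs.comp (by fun_prop))).pow_const 2).ennreal_ofReal
  calc ∫⁻ ω, ENNReal.ofReal (P' ω ^ 2) ∂μ
      ≤ ∫⁻ ω, ENNReal.ofReal (max |(I ω).1| |(I ω).2| ^ 2) ∂μ := by
        refine lintegral_mono_ae ?_
        filter_upwards [S.mem] with ω h
        refine ENNReal.ofReal_le_ofReal ?_
        rw [← sq_abs (P' ω)]
        gcongr
        exact abs_le_max_abs_abs h.1 h.2
    _ = ∫⁻ ω, ∫⁻ e : Shock, ENNReal.ofReal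
          (max |(e.interval (P ω)).1| |(e.interval (P ω)).2| ^ 2) ∂E.law ∂μ :=
        S.lintegral_eq hF
    _ ≤ ∫⁻ ω, ENNReal.ofReal (a * P ω ^ 2 + C) ∂μ := by
        refine lintegral_mono fun ω => ?_
        have h1 : ∀ᵐ e : Shock ∂E.law, ENNReal.ofReal
            (max |(e.interval (P ω)).1| |(e.interval (P ω)).2| ^ 2) ≤
            ENNReal.ofReal ((|e.A| * |P ω| + e.noise) ^ 2) := by
          filter_upwards [E.ae_interval_le] with e he
          gcongr
          exact max_le (abs_le_of_mem_interval ⟨le_rfl, he _⟩)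
            (abs_le_of_mem_interval ⟨he _, le_rfl⟩)
        refine (lintegral_mono_ae h1).trans ?_
        rw [← ofReal_integral_eq_lintegral_ofReal (hE.integrable_sq_bound _)
          (Eventually.of_forall fun e => sq_nonneg _)]
        refine ENNReal.ofReal_le_ofReal ((haC _).trans ?_)
        rw [sq_abs]

theorem memLp_next (S : FeasibleStep E μ P I P') (hE : E.MeanSquareStable) (hP : MemLp P 2 μ) :
    MemLp P' 2 μ := by
  obtain ⟨a, C, ha0, -, hC, haC⟩ := hE.exists_sq_drift
  have h := S.lintegral_sq_next_le hE haC
  have hi : Integrable (fun ω => a * P ω ^ 2 + C) μ :=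
    (hP.integrable_sq.const_mul a).add (integrable_const C)
  rw [memLp_two_iff_integrable_sq S.measurable_next.aestronglyMeasurable]
  refine ⟨(S.measurable_next.pow_const 2).aestronglyMeasurable, ?_⟩
  rw [hasFiniteIntegral_iff_ofReal (Eventually.of_forall fun ω => sq_nonneg _)]
  refine h.trans_lt ?_
  rw [← hasFiniteIntegral_iff_ofReal (Eventually.of_forall fun ω => by positivity)]
  exact hi.2

theorem integral_sq_next_le (S : FeasibleStep E μ P I P') (hE : E.MeanSquareStable)
    (hP : MemLp P 2 μ) {a C : ℝ} (ha : 0 ≤ a) (hC : 0 ≤ C)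
    (haC : ∀ s : ℝ, ∫ e : Shock, (|e.A| * s + e.noise) ^ 2 ∂E.law ≤ a * s ^ 2 + C) :
    ∫ ω, P' ω ^ 2 ∂μ ≤ a * ∫ ω, P ω ^ 2 ∂μ + C := by
  have h := S.lintegral_sq_next_le hE haC
  have hi : Integrable (fun ω => a * P ω ^ 2 + C) μ :=
    (hP.integrable_sq.const_mul a).add (integrable_const C)
  rw [← ofReal_integral_eq_lintegral_ofReal (S.memLp_next hE hP).integrable_sq
      (Eventually.of_forall fun ω => sq_nonneg _),
    ← ofReal_integral_eq_lintegral_ofReal hi (Eventually.of_forall fun ω => by positivity),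
    ENNReal.ofReal_le_ofReal_iff (integral_nonneg fun ω => by positivity),
    integral_add (hP.integrable_sq.const_mul a) (integrable_const C), integral_const_mul] at h
  simpa using h

variable {c cost z : ℝ} {h : ℝ → ℝ}

/-- The optimality equation along the path, when the unconstrained minimizer is projected. -/
theorem integral_total_proj (S : FeasibleStep E μ P I P') (hE : E.MeanSquareStable)
    (hP : MemLp P 2 μ) (H : IsRelativeValue E c cost h)
    (hz : ∀ y, (z - c) ^ 2 + h z ≤ (y - c) ^ 2 + h y) :
    ∫ ω, ((proj (I ω) z - c) ^ 2 + h (proj (I ω) z)) ∂μ = cost + ∫ ω, h (P ω) ∂μ := by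
  obtain ⟨K, hK⟩ := H.growth
  obtain ⟨K', hK'⟩ := H.growth_total
  have hi := integrable_comp_of_quadratic_growth ((S.project z).memLp_next hE hP)
    H.continuous_total hK'
  have hmeas : Measurable fun q : ℝ × ℝ × ℝ => (proj q.2 z - c) ^ 2 + h (proj q.2 z) :=
    H.continuous_total.measurable.comp ((measurable_proj_left z).comp measurable_snd)
  rw [S.integral_eq hmeas hi]
  have : ∀ ω, ∫ e : Shock, ((proj (e.interval (P ω)) z - c) ^ 2
      + h (proj (e.interval (P ω)) z)) ∂E.law = cost + h (P ω) := fun ω =>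
    (H.bellman hz (P ω)).symm
  simp only [this]
  rw [integral_add (integrable_const _)
    (integrable_comp_of_quadratic_growth hP H.continuous hK)]
  simp

/-- The optimality inequality along the path of an arbitrary feasible choice. -/
theorem cost_add_le (S : FeasibleStep E μ P I P') (hE : E.MeanSquareStable)
    (hP : MemLp P 2 μ) (H : IsRelativeValue E c cost h)
    (hz : ∀ y, (z - c) ^ 2 + h z ≤ (y - c) ^ 2 + h y) :
    cost + ∫ ω, h (P ω) ∂μ ≤ ∫ ω, ((P' ω - c) ^ 2 + h (P' ω)) ∂μ := by
  obtain ⟨K', hK'⟩ := H.growth_total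
  rw [← S.integral_total_proj hE hP H hz]
  refine integral_mono_ae (integrable_comp_of_quadratic_growth ((S.project z).memLp_next hE hP)
    H.continuous_total hK') (integrable_comp_of_quadratic_growth (S.memLp_next hE hP)
    H.continuous_total hK') ?_
  filter_upwards [S.mem] with ω hω
  exact apply_proj_le (strictConvexOn_sq_sub_add c H.convex).convexOn hz hω

/-- Equality in the optimality inequality forces the projection of the target, by strict
convexity. -/
theorem ae_eq_proj (S : FeasibleStep E μ P I P') (hE : E.MeanSquareStable)
    (hP : MemLp P 2 μ) (H : IsRelativeValue E c cost h)
    (hz : ∀ y, (z - c) ^ 2 + h z ≤ (y - c) ^ 2 + h y)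
    (heq : ∫ ω, ((P' ω - c) ^ 2 + h (P' ω)) ∂μ ≤ cost + ∫ ω, h (P ω) ∂μ) :
    ∀ᵐ ω ∂μ, P' ω = proj (I ω) z := by
  obtain ⟨K', hK'⟩ := H.growth_total
  have h1 := integrable_comp_of_quadratic_growth ((S.project z).memLp_next hE hP)
    H.continuous_total hK'
  have h2 := integrable_comp_of_quadratic_growth (S.memLp_next hE hP)
    H.continuous_total hK'
  have hconv := strictConvexOn_sq_sub_add c H.convex
  have hle : ∀ᵐ ω ∂μ, (proj (I ω) z - c) ^ 2 + h (proj (I ω) z) ≤ (P' ω - c) ^ 2 + h (P' ω) := by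
    filter_upwards [S.mem] with ω hω
    exact apply_proj_le hconv.convexOn hz hω
  rw [← S.integral_total_proj hE hP H hz] at heq
  have := (integral_eq_iff_of_ae_le h1 h2 hle).1 (le_antisymm (integral_mono_ae h1 h2 hle) heq)
  filter_upwards [this, S.mem] with ω hω hm
  exact eq_proj_of_apply_le hconv hz hm hω.ge

end FeasibleStep

/-! ### Solving the average cost optimality equation -/

section subgradients

/-- Two functions with the same monotone selection of subgradients differ by a constant. -/
theorem sub_eq_sub_of_subgradient {F h k : ℝ → ℝ}
    (hF : ∀ x y, F x + k x * (y - x) ≤ F y) (hh : ∀ x y, h x + k x * (y - x) ≤ h y) (x y : ℝ) :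
    F y - h y = F x - h x := by
  -- Halving the interval halves the bound that the two subgradient inequalities give.
  have key : ∀ n : ℕ, ∀ x y, (F y - h y) - (F x - h x) ≤ (k y - k x) * (y - x) / 2 ^ n := by
    intro n
    induction n with
    | zero =>
      intro x y
      have h1 := hF y x
      have h2 := hh x y
      simp only [pow_zero, div_one]
      linarith
    | succ n ih =>
      intro x y
      have h1 := ih x ((x + y) / 2)
      have h2 := ih ((x + y) / 2) y
      have : (k ((x + y) / 2) - k x) * ((x + y) / 2 - x) / 2 ^ n
          + (k y - k ((x + y) / 2)) * (y - (x + y) / 2) / 2 ^ n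
          = (k y - k x) * (y - x) / 2 ^ (n + 1) := by
        field_simp
        ring
      linarith
  have lim : ∀ x y, (F y - h y) - (F x - h x) ≤ 0 := by
    intro x y
    have h1 : Tendsto (fun n : ℕ => (k y - k x) * (y - x) / 2 ^ n) atTop (𝓝 0) := by
      have := (tendsto_pow_atTop_nhds_zero_of_lt_one (r := (1 / 2 : ℝ)) (by norm_num)
        (by norm_num)).const_mul ((k y - k x) * (y - x))
      simpa [div_eq_mul_inv] using this
    exact ge_of_tendsto h1 (Eventually.of_forall fun n => key n x y)
  linarith [lim x y, lim y x]

theorem convexOn_of_subgradient {h k : ℝ → ℝ} (hh : ∀ x y, h x + k x * (y - x) ≤ h y) :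
    ConvexOn ℝ univ h := by
  refine ⟨convex_univ, fun x _ y _ a b ha hb hab => ?_⟩
  have h1 := mul_le_mul_of_nonneg_left (hh (a • x + b • y) x) ha
  have h2 := mul_le_mul_of_nonneg_left (hh (a • x + b • y) y) hb
  have hb' : b = 1 - a := by linarith
  subst hb'
  simp only [smul_eq_mul] at *
  linarith

theorem integral_subgradient {k : ℝ → ℝ} (hk : Monotone k) (x y : ℝ) :
    (∫ s in (0 : ℝ)..x, k s) + k x * (y - x) ≤ ∫ s in (0 : ℝ)..y, k s := by
  have hi : ∀ a b, IntervalIntegrable k volume a b := fun a b => hk.intervalIntegrable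
  rw [← intervalIntegral.integral_add_adjacent_intervals (hi 0 x) (hi x y), add_le_add_iff_left]
  rcases le_total x y with hxy | hxy
  · have := intervalIntegral.integral_mono_on hxy (intervalIntegrable_const (c := k x)) (hi x y)
      fun s hs => hk hs.1
    simpa [mul_comm] using this
  · have := intervalIntegral.integral_mono_on hxy (hi y x) (intervalIntegrable_const (c := k x))
      fun s hs => hk hs.2
    rw [intervalIntegral.integral_symm]
    simp at this
    linarith

/-- The subgradient of the constrained minimum of `g` over a translate of an interval, expressed
by the subgradients of `g` at the two endpoints. -/
theorem constrained_min_subgradient {g γ : ℝ → ℝ} (hg : ∀ x y, g x + γ x * (y - x) ≤ g y)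
    {z : ℝ} (hz : ∀ y, g z ≤ g y) {I : ℝ × ℝ} (hI : I.1 ≤ I.2) {δ y : ℝ}
    (h1 : I.1 + δ ≤ y) (h2 : y ≤ I.2 + δ) :
    g (proj I z) + max (γ I.1) (min 0 (γ I.2)) * δ ≤ g y := by
  have hconv := convexOn_of_subgradient hg
  have hL : g (proj I z) ≤ g I.1 := apply_proj_le hconv hz ⟨le_rfl, hI⟩
  have hR : g (proj I z) ≤ g I.2 := apply_proj_le hconv hz ⟨hI, le_rfl⟩
  have sL := hg I.1 y
  have sR := hg I.2 y
  rcases lt_or_ge 0 (γ I.1) with hp | hp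
  · rw [max_eq_left ((min_le_left _ _).trans hp.le)]
    nlinarith
  · rcases lt_or_ge (γ I.2) 0 with hn | hn
    · have hmono : γ I.1 ≤ γ I.2 := by
        rcases hI.eq_or_lt with he | hlt
        · rw [he]
        · have a1 := hg I.1 I.2
          have a2 := hg I.2 I.1
          have : (γ I.1 - γ I.2) * (I.2 - I.1) ≤ 0 := by linarith
          by_contra! hcon
          have := mul_pos (sub_pos.2 hcon) (sub_pos.2 hlt)
          linarith
      rw [min_eq_right hn.le, max_eq_right hmono]
      nlinarith
    · rw [min_eq_left hn, max_eq_right hp, zero_mul, add_zero]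
      rcases lt_or_ge y I.1 with hy | hy
      · nlinarith
      · rcases lt_or_ge I.2 y with hy' | hy'
        · nlinarith
        · exact apply_proj_le hconv hz ⟨hy, hy'⟩

end subgradients

/-- The slope of the constrained minimum as a function of the previous action, for the shock `e`,
when `s ↦ 2 (s - c) + k s` is the slope of the current cost plus the relative value. -/
def shockSlope (c : ℝ) (k : ℝ → ℝ) (e : Shock) (x : ℝ) : ℝ :=
  e.A * max (2 * ((e.interval x).1 - c) + k (e.interval x).1)
    (min 0 (2 * ((e.interval x).2 - c) + k (e.interval x).2))

/-- The derivative of the optimality operator, acting on slopes of relative value functions. -/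
def slopeOp (E : Environment) (c : ℝ) (k : ℝ → ℝ) (x : ℝ) : ℝ :=
  ∫ e : Shock, shockSlope c k e x ∂E.law

theorem abs_interval_fst_le (e : Shock) (x : ℝ) :
    |(e.interval x).1| ≤ |e.A| * |x| + e.noise := by
  unfold Shock.interval Shock.noise
  rw [← abs_mul]
  linarith [abs_add_le (e.A * x + e.B) e.U, abs_add_le (e.A * x) e.B, abs_nonneg e.V]

theorem abs_interval_snd_le (e : Shock) (x : ℝ) :
    |(e.interval x).2| ≤ |e.A| * |x| + e.noise := by
  unfold Shock.interval Shock.noise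
  rw [← abs_mul]
  linarith [abs_add_le (e.A * x + e.B) e.V, abs_add_le (e.A * x) e.B, abs_nonneg e.U]

theorem abs_max_min_sub_le (a b a' b' : ℝ) :
    |max a (min 0 b) - max a' (min 0 b')| ≤ max |a - a'| |b - b'| := by
  refine (abs_max_sub_max_le_max _ _ _ _).trans (max_le_max le_rfl ?_)
  simpa using abs_min_sub_min_le_max 0 b 0 b'

theorem weighted_bound_le {ε M s t n : ℝ} (hε : 0 < ε) (hM : 0 ≤ M) (hn : 0 ≤ n)
    (hst : t ≤ s + n) : M * (1 + ε * t) ≤ M * (1 + ε * (s + 2 * n)) := by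
  gcongr
  linarith

section slopes

variable {E : Environment} {c ε r : ℝ} {k k' : ℝ → ℝ}

theorem measurable_shockSlope (hk : Monotone k) (x : ℝ) :
    Measurable fun e : Shock => shockSlope c k e x := by
  have hm := hk.measurable
  have h1 : Measurable fun e : Shock => (e.interval x).1 := (measurable_interval_left x).fst
  have h2 : Measurable fun e : Shock => (e.interval x).2 := (measurable_interval_left x).snd
  unfold shockSlope
  exact Measurable.mul (by fun_prop) ((((h1.sub_const c).const_mul 2).add (hm.comp h1)).max
    (measurable_const.min (((h2.sub_const c).const_mul 2).add (hm.comp h2))))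

theorem abs_shockSlope_sub_le (hε : 0 < ε) {M : ℝ} (hM : 0 ≤ M)
    (h : ∀ x, |k x - k' x| ≤ M * (1 + ε * |x|)) (e : Shock) (x : ℝ) :
    |shockSlope c k e x - shockSlope c k' e x| ≤
      M * (|e.A| * (1 + ε * (|e.A| * |x| + 2 * e.noise))) := by
  unfold shockSlope
  rw [← mul_sub, abs_mul, mul_left_comm]
  gcongr
  refine (abs_max_min_sub_le _ _ _ _).trans (max_le ?_ ?_)
  · rw [add_sub_add_left_eq_sub]
    exact (h _).trans (weighted_bound_le hε hM e.noise_nonneg (abs_interval_fst_le e x))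
  · rw [add_sub_add_left_eq_sub]
    exact (h _).trans (weighted_bound_le hε hM e.noise_nonneg (abs_interval_snd_le e x))

theorem abs_shockSlope_le (hε : 0 < ε) {M : ℝ} (hM : 0 ≤ M)
    (h : ∀ x, |k x| ≤ M * (1 + ε * |x|)) (e : Shock) (x : ℝ) :
    |shockSlope c k e x| ≤
      (2 * |c| + 2 / ε + M) * (|e.A| * (1 + ε * (|e.A| * |x| + 2 * e.noise))) := by
  -- The slope operator vanishes on the slope `s ↦ -2 (s - c)`, so compare with that one.
  have h0 : shockSlope c (fun s => -(2 * (s - c))) e x = 0 := by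
    simp [shockSlope]
  have := abs_shockSlope_sub_le (c := c) (k := k) (k' := fun s => -(2 * (s - c))) hε
    (M := 2 * |c| + 2 / ε + M) (by positivity) (fun y => ?_) e x
  · rwa [h0, sub_zero] at this
  · have h1 := h y
    have h2 : |k y - -(2 * (y - c))| ≤ |k y| + 2 * (|y| + |c|) := by
      rw [sub_neg_eq_add]
      refine (abs_add_le _ _).trans ?_
      rw [abs_mul, abs_two]
      gcongr
      exact abs_sub _ _
    have h3 : 2 / ε * (ε * |y|) = 2 * |y| := by field_simp
    have h4 : 0 ≤ 2 * |c| * (ε * |y|) := by positivity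
    have h5 : 0 ≤ 2 / ε := by positivity
    linarith

theorem monotone_shockSlope (hk : Monotone k) (e : Shock) : Monotone (shockSlope c k e) := by
  have hm : Monotone fun s => 2 * (s - c) + k s := fun s t hst => by
    have := hk hst
    simp only
    linarith
  intro x y hxy
  unfold shockSlope
  rcases le_total 0 e.A with hA | hA
  · have h1 : e.A * x ≤ e.A * y := mul_le_mul_of_nonneg_left hxy hA
    refine mul_le_mul_of_nonneg_left (max_le_max (hm ?_) (min_le_min le_rfl (hm ?_))) hA <;>
    · unfold Shock.interval
      simp only
      linarith
  · have h1 : e.A * y ≤ e.A * x := mul_le_mul_of_nonpos_left hxy hA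
    refine mul_le_mul_of_nonpos_left (max_le_max (hm ?_) (min_le_min le_rfl (hm ?_))) hA <;>
    · unfold Shock.interval
      simp only
      linarith

variable (hE : E.MeanSquareStable) (hε : 0 < ε)
  (hr : ∀ s, 0 ≤ s →
    ∫ e : Shock, |e.A| * (1 + ε * (|e.A| * s + 2 * e.noise)) ∂E.law ≤ r * (1 + ε * s))

include hE hε in
theorem integrable_shockSlope (hk : Monotone k) {M : ℝ} (hM : 0 ≤ M)
    (h : ∀ x, |k x| ≤ M * (1 + ε * |x|)) (x : ℝ) :
    Integrable (fun e : Shock => shockSlope c k e x) E.law :=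
  ((hE.integrable_weight ε |x| 2).const_mul _).mono'
    (measurable_shockSlope hk x).aestronglyMeasurable
    (Eventually.of_forall fun e => abs_shockSlope_le hε hM h e x)

include hE hε in
theorem monotone_slopeOp (hk : Monotone k) {M : ℝ} (hM : 0 ≤ M)
    (h : ∀ x, |k x| ≤ M * (1 + ε * |x|)) : Monotone (slopeOp E c k) := fun x y hxy =>
  integral_mono (integrable_shockSlope hE hε hk hM h x) (integrable_shockSlope hE hε hk hM h y)
    fun e => monotone_shockSlope hk e hxy

include hE hε hr in
theorem abs_slopeOp_sub_le (hk : Monotone k) (hk' : Monotone k') {M M' D : ℝ} (hM : 0 ≤ M)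
    (h : ∀ x, |k x| ≤ M * (1 + ε * |x|)) (hM' : 0 ≤ M') (h' : ∀ x, |k' x| ≤ M' * (1 + ε * |x|))
    (hD : 0 ≤ D) (hsub : ∀ x, |k x - k' x| ≤ D * (1 + ε * |x|)) (x : ℝ) :
    |slopeOp E c k x - slopeOp E c k' x| ≤ D * r * (1 + ε * |x|) := by
  unfold slopeOp
  rw [← integral_sub (integrable_shockSlope hE hε hk hM h x)
    (integrable_shockSlope hE hε hk' hM' h' x)]
  refine (abs_integral_le_of_ae_abs_le ((hE.integrable_weight ε |x| 2).const_mul D)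
    (Eventually.of_forall fun e => abs_shockSlope_sub_le hε hD hsub e x)).trans ?_
  rw [integral_const_mul, mul_assoc]
  exact mul_le_mul_of_nonneg_left (hr _ (abs_nonneg x)) hD

include hE hε hr in
theorem abs_slopeOp_le {M : ℝ} (hM : 0 ≤ M) (h : ∀ x, |k x| ≤ M * (1 + ε * |x|)) (x : ℝ) :
    |slopeOp E c k x| ≤ (2 * |c| + 2 / ε + M) * r * (1 + ε * |x|) := by
  refine (abs_integral_le_of_ae_abs_le ((hE.integrable_weight ε |x| 2).const_mul _)
    (Eventually.of_forall fun e => abs_shockSlope_le hε hM h e x)).trans ?_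
  rw [integral_const_mul, mul_assoc]
  exact mul_le_mul_of_nonneg_left (hr _ (abs_nonneg x)) (by positivity)

end slopes

/-- The slope of the relative value function: the fixed point of the slope operator, which is a
contraction for the weighted supremum norm with weight `1 + ε |x|`. -/
theorem exists_slope_fixedPoint {E : Environment} (hE : E.MeanSquareStable) (c : ℝ) :
    ∃ (k : ℝ → ℝ) (ε M : ℝ), 0 < ε ∧ 0 ≤ M ∧ Monotone k ∧ (∀ x, |k x| ≤ M * (1 + ε * |x|)) ∧
      ∀ x, slopeOp E c k x = k x := by
  obtain ⟨ε, r, hε, hr0, hr1, hr⟩ := hE.exists_weight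
  set κ : ℕ → ℝ → ℝ := fun n => (slopeOp E c)^[n] 0 with hκ
  have hsucc : ∀ n, κ (n + 1) = slopeOp E c (κ n) := fun n =>
    Function.iterate_succ_apply' _ _ _
  have hclass : ∀ n, Monotone (κ n) ∧ ∃ M, 0 ≤ M ∧ ∀ x, |κ n x| ≤ M * (1 + ε * |x|) := by
    intro n
    induction n with
    | zero => exact ⟨fun _ _ _ => le_rfl, 0, le_rfl, by simp [hκ]⟩
    | succ n ih =>
      obtain ⟨hm, M, hM, hb⟩ := ih
      rw [hsucc]
      exact ⟨monotone_slopeOp hE hε hm hM hb, _, by positivity, abs_slopeOp_le hE hε hr hM hb⟩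
  obtain ⟨D, hD, hD1⟩ : ∃ D, 0 ≤ D ∧ ∀ x, |κ 0 x - κ 1 x| ≤ D * (1 + ε * |x|) := by
    obtain ⟨-, M, hM, hb⟩ := hclass 1
    exact ⟨M, hM, fun x => by simpa [hκ] using hb x⟩
  have hstep : ∀ n x, |κ n x - κ (n + 1) x| ≤ D * r ^ n * (1 + ε * |x|) := by
    intro n
    induction n with
    | zero => simpa using hD1
    | succ n ih =>
      obtain ⟨hm, M, hM, hb⟩ := hclass n
      obtain ⟨hm', M', hM', hb'⟩ := hclass (n + 1)
      intro x
      have := abs_slopeOp_sub_le (c := c) hE hε hr hm hm' hM hb hM' hb' (by positivity) ih x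
      rw [← hsucc, ← hsucc] at this
      rw [pow_succ, ← mul_assoc]
      exact this
  have hdist : ∀ x n, dist (κ n x) (κ (n + 1) x) ≤ D * (1 + ε * |x|) * r ^ n := fun x n => by
    rw [Real.dist_eq]
    linarith [hstep n x]
  have hlim : ∀ x, ∃ l, Tendsto (fun n => κ n x) atTop (𝓝 l) := fun x =>
    cauchySeq_tendsto_of_complete (cauchySeq_of_le_geometric r _ hr1 (hdist x))
  choose k hk using hlim
  have hrate : ∀ n x, |κ n x - k x| ≤ D / (1 - r) * r ^ n * (1 + ε * |x|) := by
    intro n x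
    have := dist_le_of_le_geometric_of_tendsto r _ hr1 (hdist x) (hk x) n
    rw [Real.dist_eq] at this
    refine this.trans (le_of_eq ?_)
    ring
  have hr' : 0 < 1 - r := by linarith
  have hkmono : Monotone k := fun x y hxy =>
    le_of_tendsto_of_tendsto' (hk x) (hk y) fun n => (hclass n).1 hxy
  have hkb : ∀ x, |k x| ≤ D / (1 - r) * (1 + ε * |x|) := fun x => by
    simpa [hκ] using hrate 0 x
  refine ⟨k, ε, D / (1 - r), hε, by positivity, hkmono, hkb, fun x => ?_⟩
  have h1 : Tendsto (fun n => κ (n + 1) x) atTop (𝓝 (slopeOp E c k x)) := by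
    rw [tendsto_iff_dist_tendsto_zero]
    refine squeeze_zero (fun n => dist_nonneg) (g := fun n =>
      D / (1 - r) * r ^ n * r * (1 + ε * |x|)) (fun n => ?_) ?_
    · obtain ⟨hm, M, hM, hb⟩ := hclass n
      rw [hsucc, Real.dist_eq]
      exact abs_slopeOp_sub_le hE hε hr hm hkmono hM hb (by positivity) hkb (by positivity)
        (hrate n) x
    · have := (tendsto_pow_atTop_nhds_zero_of_lt_one hr0 hr1).const_mul
        (D / (1 - r) * r * (1 + ε * |x|))
      rw [mul_zero] at this
      refine this.congr fun n => by ring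
  exact tendsto_nhds_unique h1 ((tendsto_add_atTop_iff_nat 1).2 (hk x))

theorem Environment.MeanSquareStable.memLp_anchor {E : Environment} (hE : E.MeanSquareStable)
    (z x : ℝ) : MemLp (fun e : Shock => anchor z e x) 2 E.law := by
  refine ((hE.memLp_A.abs.mul_const |x|).add hE.memLp_noise).mono'
    (measurable_anchor_left z x).aestronglyMeasurable ?_
  filter_upwards [E.base_nonempty] with e he using abs_anchor_le he z x

/-- For every center the average cost optimality equation has a solution whose sum with the current
cost attains its minimum. -/
theorem exists_isRelativeValue {E : Environment} (hE : E.MeanSquareStable) (c : ℝ) :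
    ∃ (cost : ℝ) (h : ℝ → ℝ) (z : ℝ), IsRelativeValue E c cost h ∧
      ∀ y, (z - c) ^ 2 + h z ≤ (y - c) ^ 2 + h y := by
  obtain ⟨k, ε, M, hε, hM, hk, hkb, hfix⟩ := exists_slope_fixedPoint hE c
  set h : ℝ → ℝ := fun x => ∫ s in (0 : ℝ)..x, k s with hh
  have hsub : ∀ x y, h x + k x * (y - x) ≤ h y := integral_subgradient hk
  have hconv : ConvexOn ℝ univ h := convexOn_of_subgradient hsub
  have hcont : Continuous h := by
    rw [← continuousOn_univ]; exact hconv.continuousOn isOpen_univ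
  have hgrow : ∀ x, |h x| ≤ (2 * M * (1 + ε)) * (1 + x ^ 2) := by
    intro x
    have h0 : h 0 = 0 := by simp [hh]
    have h1 := hsub 0 x
    have h2 := hsub x 0
    have b0 := hkb 0
    have b1 := hkb x
    rw [h0] at h1 h2
    have hx : |h x| ≤ M * (1 + ε * |x|) * |x| := by
      rw [abs_le]
      have a1 : |k 0 * x| ≤ M * (1 + ε * |x|) * |x| := by
        rw [abs_mul]
        gcongr
        refine b0.trans ?_
        rw [abs_zero, mul_zero, add_zero, mul_one]
        nlinarith [mul_nonneg hM (mul_nonneg hε.le (abs_nonneg x))]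
      have a2 : |k x * x| ≤ M * (1 + ε * |x|) * |x| := by
        rw [abs_mul]
        gcongr
      constructor
      · linarith [neg_abs_le (k 0 * x)]
      · linarith [le_abs_self (k x * x)]
    refine hx.trans ?_
    have e1 := sq_abs x
    have : (1 + ε * |x|) * |x| ≤ 2 * (1 + ε) * (1 + x ^ 2) := by
      nlinarith [sq_nonneg (|x| - 1), abs_nonneg x, mul_nonneg hε.le (sq_nonneg x)]
    nlinarith
  set g : ℝ → ℝ := fun y => (y - c) ^ 2 + h y with hg
  have hgcont : Continuous g := by fun_prop
  have hgsub : ∀ x y, g x + (2 * (x - c) + k x) * (y - x) ≤ g y := by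
    intro x y
    have := hsub x y
    simp only [hg]
    nlinarith [sq_nonneg (y - x)]
  obtain ⟨z, hz⟩ : ∃ z, ∀ y, g z ≤ g y := by
    refine hgcont.exists_forall_le' c ?_
    filter_upwards [(isCompact_closedBall c |k c|).compl_mem_cocompact] with y hy
    have hy' : |k c| < |y - c| := by simpa [Real.dist_eq] using hy
    have h1 := hsub c y
    have h2 : |k c * (y - c)| ≤ |y - c| ^ 2 := by
      rw [abs_mul, sq]; gcongr
    rw [sq_abs] at h2
    simp only [hg, sub_self]
    linarith [neg_abs_le (k c * (y - c))]
  obtain ⟨K, hK⟩ := quadratic_growth_sq_sub_add c hgrow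
  have hint : ∀ x, Integrable (fun e : Shock => g (anchor z e x)) E.law := fun x =>
    integrable_comp_of_quadratic_growth (hE.memLp_anchor z x) hgcont hK
  have hmin : ∀ x, (fun e : Shock => sInf (g '' Icc (e.interval x).1 (e.interval x).2))
      =ᵐ[E.law] fun e => g (anchor z e x) := fun x => by
    filter_upwards [E.ae_interval_le] with e he
    exact sInf_image_Icc_eq (convexOn_of_subgradient hgsub) hz (he x)
  set F : ℝ → ℝ := fun x => ∫ e : Shock, g (anchor z e x) ∂E.law with hF
  have hFsub : ∀ x y, F x + k x * (y - x) ≤ F y := by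
    intro x y
    have hs := integrable_shockSlope (c := c) hE hε hk hM hkb x
    rw [← hfix x, slopeOp, ← integral_mul_const, hF]
    simp only
    rw [← integral_add (hint x) (hs.mul_const _)]
    refine integral_mono_ae ((hint x).add (hs.mul_const _)) (hint y) ?_
    filter_upwards [E.ae_interval_le] with e he
    obtain ⟨p1, p2⟩ := proj_mem (he y) z
    have := constrained_min_subgradient hgsub hz (he x) (δ := e.A * (y - x))
      (y := anchor z e y) (le_trans (le_of_eq ?_) p1) (p2.trans (le_of_eq ?_))
    · simp only [shockSlope]
      simp only [anchor] at this ⊢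
      linarith
    · unfold Shock.interval; simp only; ring
    · unfold Shock.interval; simp only; ring
  refine ⟨F 0 - h 0, h, z, ⟨hconv, ⟨_, hgrow⟩, fun x => ?_, fun x => ?_⟩, hz⟩
  · exact (hint x).congr (hmin x).symm
  · rw [integral_congr_ae (hmin x)]
    have := sub_eq_sub_of_subgradient hFsub hsub 0 x
    change F 0 - h 0 + h x = F x
    linarith

/-! ### Stationary actions from an infinite past -/

/-- A feasible choice, as a function of the current shock and of independent randomness that carries
the previous action. -/
theorem FeasibleStep.of_prod (E : Environment) {Ω : Type*} [MeasurableSpace Ω] {ν : Measure Ω}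
    [IsProbabilityMeasure ν] {P : Ω → ℝ} (hP : Measurable P) {P' : Ω × Shock → ℝ}
    (hP' : Measurable P')
    (hmem : ∀ᵐ q ∂ν.prod E.law, P' q ∈ Icc (q.2.interval (P q.1)).1 (q.2.interval (P q.1)).2) :
    FeasibleStep E (ν.prod E.law) (fun q => P q.1) (fun q => q.2.interval (P q.1)) P' where
  measurable_prev := hP.comp measurable_fst
  measurable_interval :=
    FeasibleInterval.measurable_interval.comp ((hP.comp measurable_fst).prodMk measurable_snd)
  measurable_next := hP'
  map_eq := by
    have h1 : (ν.prod E.law).map (fun q => P q.1) = ν.map P := by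
      rw [show (fun q : Ω × Shock => P q.1) = P ∘ Prod.fst from rfl,
        ← Measure.map_map hP measurable_fst, Measure.map_fst_prod]
      simp
    have h2 : (ν.map P).prod E.law = (ν.prod E.law).map (Prod.map P id) := by
      rw [← Measure.map_prod_map _ _ hP measurable_id, Measure.map_id]
    rw [h1, h2, Measure.map_map (by fun_prop) (hP.prodMap measurable_id)]
    rfl
  mem := hmem

theorem Environment.ae_prod_base_nonempty (E : Environment) {Ω : Type*} [MeasurableSpace Ω]
    (ν : Measure Ω) : ∀ᵐ q ∂ν.prod E.law, q.2.U ≤ q.2.V :=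
  Measure.quasiMeasurePreserving_snd.ae E.base_nonempty

section stationaryCoupling

/-- The past shocks of a stationary environment, the most recent one at index `0`. -/
abbrev ShockStream : Type := ℕ → Shock

/-- The law of an i.i.d. past. -/
def Environment.streamLaw (E : Environment) : Measure ShockStream :=
  Measure.infinitePi fun _ => E.law

instance (E : Environment) : IsProbabilityMeasure E.streamLaw := by
  unfold Environment.streamLaw; infer_instance

/-- The past as seen one period later. -/
def ShockStream.push (q : ShockStream × Shock) : ShockStream
  | 0 => q.2
  | n + 1 => q.1 n

theorem measurable_push : Measurable ShockStream.push := by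
  refine measurable_pi_lambda _ fun n => ?_
  cases n with
  | zero => exact measurable_snd
  | succ n => exact (measurable_pi_apply n).comp measurable_fst

theorem measurePreserving_push (E : Environment) :
    MeasurePreserving ShockStream.push (E.streamLaw.prod E.law) E.streamLaw := by
  refine ⟨measurable_push, Measure.eq_infinitePi _ fun s t ht => ?_⟩
  classical
  obtain ⟨N, hN⟩ : ∃ N, s ⊆ Finset.range (N + 1) := by
    obtain ⟨N, hN⟩ := s.exists_nat_subset_range
    exact ⟨N, hN.trans (Finset.range_subset_range.2 (Nat.le_succ N))⟩
  set t' : ℕ → Set Shock := fun i => if i ∈ s then t i else univ with ht'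
  have hmeas : ∀ i, MeasurableSet (t' i) := fun i => by
    simp only [ht']; split_ifs
    exacts [ht i, MeasurableSet.univ]
  have hprod : ∏ i ∈ s, E.law (t i) = ∏ i ∈ Finset.range (N + 1), E.law (t' i) := by
    rw [← Finset.prod_subset hN fun i _ hi => by simp [ht', hi]]
    exact Finset.prod_congr rfl fun i hi => by simp [ht', hi]
  have hpre : ShockStream.push ⁻¹' ((s : Set ℕ).pi t) =
      ((Finset.range N : Finset ℕ) : Set ℕ).pi (fun n => t' (n + 1)) ×ˢ t' 0 := by
    ext q
    simp only [mem_preimage, mem_prod, Set.mem_pi, ht']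
    constructor
    · intro h
      refine ⟨fun n _ => ?_, ?_⟩
      · split_ifs with hs
        exacts [h (n + 1) hs, mem_univ _]
      · split_ifs with hs
        exacts [h 0 hs, mem_univ _]
    · rintro ⟨h1, h0⟩ i hi
      cases i with
      | zero =>
        have hi' : 0 ∈ s := hi
        rw [if_pos hi'] at h0
        exact h0
      | succ n =>
        have hi' : n + 1 ∈ s := hi
        have hn : n ∈ Finset.range N := by
          have := Finset.mem_range.1 (hN hi')
          exact Finset.mem_range.2 (by omega)
        have := h1 n hn
        rw [if_pos hi'] at this
        exact this
  rw [Measure.map_apply measurable_push (MeasurableSet.pi s.countable_toSet fun i _ => ht i), hpre,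
    Measure.prod_prod, Environment.streamLaw, Measure.infinitePi_pi _ (fun i _ => hmeas _), hprod,
    Finset.prod_range_succ']

/-- The current action after `n` periods of the anchoring rule started at `0`. -/
def backwardAction (z : ℝ) : ℕ → ShockStream → ℝ
  | 0, _ => 0
  | n + 1, ω => anchor z (ω 0) (backwardAction z n fun i => ω (i + 1))

theorem backwardAction_push (z : ℝ) (n : ℕ) (q : ShockStream × Shock) :
    backwardAction z (n + 1) (ShockStream.push q) = anchor z q.2 (backwardAction z n q.1) := rfl

theorem measurable_backwardAction (z : ℝ) (n : ℕ) : Measurable (backwardAction z n) := by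
  induction n with
  | zero => exact measurable_const
  | succ n ih =>
    have : Measurable fun ω : ShockStream => fun i => ω (i + 1) := by fun_prop
    exact (measurable_anchor z).comp ((ih.comp this).prodMk (measurable_pi_apply 0))

/-- The action of the anchoring rule after an infinite past. Where the backward iterates diverge
this is a junk value, on a null set. -/
def stationaryAction (z : ℝ) (ω : ShockStream) : ℝ :=
  limsup (fun n => backwardAction z n ω) atTop

theorem measurable_stationaryAction (z : ℝ) : Measurable (stationaryAction z) :=
  Measurable.limsup (measurable_backwardAction z)

/-- The law of the action under the anchoring rule after an infinite past. -/
def stationaryLaw (E : Environment) (z : ℝ) : Measure ℝ := E.streamLaw.map (stationaryAction z)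

instance (E : Environment) (z : ℝ) : IsProbabilityMeasure (stationaryLaw E z) :=
  Measure.isProbabilityMeasure_map (measurable_stationaryAction z).aemeasurable

variable {E : Environment}

theorem feasibleStep_backwardAction (E : Environment) (z : ℝ) (n : ℕ) :
    FeasibleStep E (E.streamLaw.prod E.law) (fun q => backwardAction z n q.1)
      (fun q => q.2.interval (backwardAction z n q.1))
      (fun q => backwardAction z (n + 1) (ShockStream.push q)) := by
  refine FeasibleStep.of_prod E (measurable_backwardAction z n)
    ((measurable_backwardAction z (n + 1)).comp measurable_push) ?_
  filter_upwards [E.ae_prod_base_nonempty E.streamLaw] with q hq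
  exact proj_mem (interval_fst_le_snd hq _) z

theorem Environment.MeanSquareStable.memLp_backwardAction (hE : E.MeanSquareStable) (z : ℝ)
    (n : ℕ) : MemLp (backwardAction z n) 2 E.streamLaw := by
  induction n with
  | zero => exact memLp_const 0
  | succ n ih =>
    rw [← (measurePreserving_push E).map_eq,
      memLp_map_measure_iff (measurable_backwardAction z _).aestronglyMeasurable
        measurable_push.aemeasurable]
    exact (feasibleStep_backwardAction E z n).memLp_next hE (ih.comp_fst E.law)

theorem Environment.MeanSquareStable.integral_sq_backwardAction_le (hE : E.MeanSquareStable)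
    (z : ℝ) {a C : ℝ} (ha : 0 ≤ a) (ha1 : a < 1) (hC : 0 ≤ C)
    (haC : ∀ s : ℝ, ∫ e : Shock, (|e.A| * s + e.noise) ^ 2 ∂E.law ≤ a * s ^ 2 + C) (n : ℕ) :
    ∫ ω, backwardAction z n ω ^ 2 ∂E.streamLaw ≤ C / (1 - a) := by
  have ha' : 0 < 1 - a := by linarith
  induction n with
  | zero =>
    simp only [backwardAction]
    simp
    positivity
  | succ n ih =>
    have h := (feasibleStep_backwardAction E z n).integral_sq_next_le hE
      ((hE.memLp_backwardAction z n).comp_fst E.law) ha hC haC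
    have h1 : ∫ q, backwardAction z (n + 1) (ShockStream.push q) ^ 2 ∂E.streamLaw.prod E.law
        = ∫ ω, backwardAction z (n + 1) ω ^ 2 ∂E.streamLaw := by
      conv_rhs => rw [← (measurePreserving_push E).map_eq]
      rw [integral_map measurable_push.aemeasurable
        ((measurable_backwardAction z _).pow_const 2).aestronglyMeasurable]
    have h2 : ∫ q, backwardAction z n q.1 ^ 2 ∂E.streamLaw.prod E.law
        = ∫ ω, backwardAction z n ω ^ 2 ∂E.streamLaw := by
      rw [integral_fun_fst (fun ω => backwardAction z n ω ^ 2)]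
      simp
    rw [h1, h2] at h
    refine h.trans ?_
    calc a * ∫ ω, backwardAction z n ω ^ 2 ∂E.streamLaw + C ≤ a * (C / (1 - a)) + C := by gcongr
      _ = C / (1 - a) := by field_simp; ring

theorem Environment.MeanSquareStable.lintegral_enorm_A_lt_one (hE : E.MeanSquareStable) :
    ∫⁻ e : Shock, ‖e.A‖ₑ ∂E.law < 1 := by
  rw [← ofReal_integral_norm_eq_lintegral_enorm (hE.memLp_A.integrable one_le_two)]
  exact ENNReal.ofReal_lt_one.2 hE.integral_abs_A_lt_one

theorem Environment.MeanSquareStable.ae_tendsto_backwardAction (hE : E.MeanSquareStable) (z : ℝ) :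
    ∀ᵐ ω ∂E.streamLaw,
      Tendsto (fun n => backwardAction z n ω) atTop (𝓝 (stationaryAction z ω)) := by
  set m := ∫⁻ e : Shock, ‖e.A‖ₑ ∂E.law with hm
  have hm1 : m < 1 := hE.lintegral_enorm_A_lt_one
  have hmeas : ∀ n, Measurable fun ω => edist (backwardAction z n ω) (backwardAction z (n + 1) ω) :=
    fun n => (measurable_backwardAction z n).edist (measurable_backwardAction z (n + 1))
  set δ : ℕ → ℝ≥0∞ := fun n =>
    ∫⁻ ω, edist (backwardAction z n ω) (backwardAction z (n + 1) ω) ∂E.streamLaw with hδ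
  have hstep : ∀ n, δ (n + 1) ≤ m * δ n := by
    intro n
    calc δ (n + 1) = ∫⁻ q, edist (backwardAction z (n + 1) (ShockStream.push q))
          (backwardAction z (n + 2) (ShockStream.push q)) ∂E.streamLaw.prod E.law :=
          ((measurePreserving_push E).lintegral_comp (hmeas (n + 1))).symm
      _ ≤ ∫⁻ q, edist (backwardAction z n q.1) (backwardAction z (n + 1) q.1) * ‖q.2.A‖ₑ
            ∂E.streamLaw.prod E.law := by
          refine lintegral_mono fun q => ?_
          rw [backwardAction_push, backwardAction_push, mul_comm, edist_eq_enorm_sub,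
            edist_eq_enorm_sub, ← enorm_mul, ← ofReal_norm, ← ofReal_norm, norm_mul]
          exact ENNReal.ofReal_le_ofReal (abs_anchor_sub_le z q.2 _ _)
      _ = δ n * m := lintegral_prod_mul (g := fun e : Shock => ‖e.A‖ₑ)
          (hmeas n).aemeasurable (by fun_prop)
      _ = m * δ n := mul_comm _ _
  have hgeo : ∀ n, δ n ≤ m ^ n * δ 0 := by
    intro n
    induction n with
    | zero => simp
    | succ n ih =>
      calc δ (n + 1) ≤ m * δ n := hstep n
        _ ≤ m * (m ^ n * δ 0) := by gcongr
        _ = m ^ (n + 1) * δ 0 := by rw [pow_succ']; ring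
  have hδ0 : δ 0 ≠ ∞ := by
    have hi := (hE.memLp_backwardAction z 1).integrable one_le_two
    have : δ 0 = ∫⁻ ω, ‖backwardAction z 1 ω‖ₑ ∂E.streamLaw := by
      refine lintegral_congr fun ω => ?_
      rw [edist_comm, edist_eq_enorm_sub]
      simp [backwardAction]
    rw [this]
    exact hi.2.ne
  have hsum : ∫⁻ ω, ∑' n, edist (backwardAction z n ω) (backwardAction z (n + 1) ω)
      ∂E.streamLaw ≠ ∞ := by
    rw [lintegral_tsum fun n => (hmeas n).aemeasurable]
    refine ne_top_of_le_ne_top ?_ (ENNReal.tsum_le_tsum hgeo)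
    rw [ENNReal.tsum_mul_right, ENNReal.tsum_geometric]
    exact ENNReal.mul_ne_top (ENNReal.inv_ne_top.2 (tsub_pos_of_lt hm1).ne') hδ0
  filter_upwards [ae_lt_top (Measurable.tsum hmeas) hsum] with ω hω
  obtain ⟨l, hl⟩ := cauchySeq_tendsto_of_complete
    (cauchySeq_of_edist_le_of_tsum_ne_top _ (fun n => le_rfl) hω.ne)
  rw [stationaryAction, hl.limsup_eq]
  exact hl

theorem continuous_anchor (z : ℝ) (e : Shock) : Continuous (anchor z e) := by
  unfold anchor proj Shock.interval
  fun_prop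

/-- The stationary actions for all targets follow the anchoring rules simultaneously, driven by the
same shocks. -/
theorem Environment.MeanSquareStable.ae_stationaryAction_push (hE : E.MeanSquareStable) (z : ℝ) :
    ∀ᵐ q ∂E.streamLaw.prod E.law,
      stationaryAction z (ShockStream.push q) = anchor z q.2 (stationaryAction z q.1) := by
  filter_upwards [Measure.quasiMeasurePreserving_fst.ae (hE.ae_tendsto_backwardAction z),
    (measurePreserving_push E).quasiMeasurePreserving.ae (hE.ae_tendsto_backwardAction z)]
    with q h1 h2
  refine tendsto_nhds_unique ((tendsto_add_atTop_iff_nat 1).2 h2) ?_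
  simp only [backwardAction_push]
  exact ((continuous_anchor z q.2).tendsto _).comp h1

theorem Environment.MeanSquareStable.memLp_stationaryAction (hE : E.MeanSquareStable) (z : ℝ) :
    MemLp (stationaryAction z) 2 E.streamLaw := by
  obtain ⟨a, C, ha0, ha1, hC, haC⟩ := hE.exists_sq_drift
  rw [memLp_two_iff_integrable_sq (measurable_stationaryAction z).aestronglyMeasurable]
  refine ⟨((measurable_stationaryAction z).pow_const 2).aestronglyMeasurable, ?_⟩
  rw [hasFiniteIntegral_iff_ofReal (Eventually.of_forall fun ω => sq_nonneg _)]
  have h1 : ∫⁻ ω, ENNReal.ofReal (stationaryAction z ω ^ 2) ∂E.streamLaw =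
      ∫⁻ ω, liminf (fun n => ENNReal.ofReal (backwardAction z n ω ^ 2)) atTop ∂E.streamLaw := by
    refine lintegral_congr_ae ?_
    filter_upwards [hE.ae_tendsto_backwardAction z] with ω hω
    exact (ENNReal.tendsto_ofReal (hω.pow 2)).liminf_eq.symm
  have h2 : ∀ n, ∫⁻ ω, ENNReal.ofReal (backwardAction z n ω ^ 2) ∂E.streamLaw ≤
      ENNReal.ofReal (C / (1 - a)) := fun n => by
    rw [← ofReal_integral_eq_lintegral_ofReal (hE.memLp_backwardAction z n).integrable_sq
      (Eventually.of_forall fun ω => sq_nonneg _)]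
    exact ENNReal.ofReal_le_ofReal (hE.integral_sq_backwardAction_le z ha0 ha1 hC haC n)
  rw [h1]
  refine (lintegral_liminf_le fun n =>
    ((measurable_backwardAction z n).pow_const 2).ennreal_ofReal).trans_lt ?_
  exact (liminf_le_of_le (by isBoundedDefault)
    fun b hb => (hb.exists.choose_spec).trans (h2 _)).trans_lt ENNReal.ofReal_lt_top

end stationaryCoupling

/-- `ψ` is invariant for one period of the anchoring rule with target `z`. -/
def AnchorInvariant (E : Environment) (z : ℝ) (ψ : Measure ℝ) : Prop :=
  (ψ.prod E.law).map (fun q : ℝ × Shock => anchor z q.2 q.1) = ψ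

theorem Environment.MeanSquareStable.anchorInvariant_stationaryLaw {E : Environment}
    (hE : E.MeanSquareStable) (z : ℝ) : AnchorInvariant E z (stationaryLaw E z) := by
  have hX := measurable_stationaryAction z
  have h2 : (stationaryLaw E z).prod E.law =
      (E.streamLaw.prod E.law).map (Prod.map (stationaryAction z) id) := by
    rw [← Measure.map_prod_map _ _ hX measurable_id, Measure.map_id]
    rfl
  rw [AnchorInvariant, h2, Measure.map_map (measurable_anchor z) (hX.prodMap measurable_id)]
  conv_rhs => rw [stationaryLaw, ← (measurePreserving_push E).map_eq,
    Measure.map_map hX measurable_push]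
  refine Measure.map_congr ?_
  filter_upwards [hE.ae_stationaryAction_push z] with q hq
  exact hq.symm

theorem Environment.MeanSquareStable.memLp_stationaryLaw {E : Environment}
    (hE : E.MeanSquareStable) (z : ℝ) : MemLp id 2 (stationaryLaw E z) := by
  rw [stationaryLaw, memLp_map_measure_iff (by fun_prop)
    (measurable_stationaryAction z).aemeasurable]
  exact hE.memLp_stationaryAction z

/-! ### Ergodicity of the anchoring rule -/

/-- The transition operator of the anchoring rule with target `z`. -/
def transition (E : Environment) (z : ℝ) (f : ℝ → ℝ) (x : ℝ) : ℝ :=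
  ∫ e : Shock, f (anchor z e x) ∂E.law

/-- Local Lipschitz continuity with a constant growing linearly in the position; convex functions of
quadratic growth have this property. -/
def LinearLipschitz (ε C : ℝ) (f : ℝ → ℝ) : Prop :=
  ∀ x y, |f x - f y| ≤ C * (|x - y| * (1 + ε * (|x| + |y|)))

theorem LinearLipschitz.continuous {ε C : ℝ} {f : ℝ → ℝ} (hf : LinearLipschitz ε C f) :
    Continuous f := by
  rw [continuous_iff_continuousAt]
  intro x
  rw [ContinuousAt, tendsto_iff_dist_tendsto_zero]
  refine squeeze_zero (fun _ => dist_nonneg) (fun y => hf y x) ?_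
  have : Continuous fun y => C * (|y - x| * (1 + ε * (|y| + |x|))) := by fun_prop
  simpa using this.tendsto x

theorem LinearLipschitz.growth {ε C : ℝ} {f : ℝ → ℝ} (hε : 0 < ε) (hC : 0 ≤ C)
    (hf : LinearLipschitz ε C f) : ∃ K, ∀ x, |f x| ≤ K * (1 + x ^ 2) := by
  refine ⟨|f 0| + C * (1 + ε), fun x => ?_⟩
  have h1 := hf x 0
  have h2 : |f x| ≤ |f x - f 0| + |f 0| := by
    have := abs_add_le (f x - f 0) (f 0)
    simpa using this
  simp only [sub_zero, abs_zero, add_zero] at h1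
  have h3 := sq_abs x
  have h4 : |x| * (1 + ε * |x|) ≤ (1 + ε) * (1 + x ^ 2) := by
    nlinarith [sq_nonneg (|x| - 1), abs_nonneg x]
  have h5 : C * (|x| * (1 + ε * |x|)) ≤ C * ((1 + ε) * (1 + x ^ 2)) := by gcongr
  nlinarith [mul_nonneg (abs_nonneg (f 0)) (sq_nonneg x)]

theorem LinearLipschitz.integrable_anchor {E : Environment} (hE : E.MeanSquareStable) {ε C : ℝ}
    {f : ℝ → ℝ} (hε : 0 < ε) (hC : 0 ≤ C) (hf : LinearLipschitz ε C f) (z x : ℝ) :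
    Integrable (fun e : Shock => f (anchor z e x)) E.law := by
  obtain ⟨K, hK⟩ := hf.growth hε hC
  exact integrable_comp_of_quadratic_growth (hE.memLp_anchor z x) hf.continuous hK

/-- One period of an anchoring rule contracts the weighted Lipschitz constant. -/
theorem LinearLipschitz.transition {E : Environment} (hE : E.MeanSquareStable) {ε r C : ℝ}
    (hε : 0 < ε) (hr : ∀ s, 0 ≤ s →
      ∫ e : Shock, |e.A| * (1 + ε * (|e.A| * s + 2 * e.noise)) ∂E.law ≤ r * (1 + ε * s))
    {f : ℝ → ℝ} (hC : 0 ≤ C) (hf : LinearLipschitz ε C f) (z : ℝ) :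
    LinearLipschitz ε (C * r) (transition E z f) := by
  intro x y
  unfold FeasibleInterval.transition
  rw [← integral_sub (hf.integrable_anchor hE hε hC z x) (hf.integrable_anchor hE hε hC z y)]
  refine (abs_integral_le_of_ae_abs_le ((hE.integrable_weight ε (|x| + |y|) 2).const_mul
    (C * |x - y|)) ?_).trans ?_
  · filter_upwards [E.base_nonempty] with e he
    refine (hf _ _).trans ?_
    have h1 := abs_anchor_le he z x
    have h2 := abs_anchor_le he z y
    calc C * (|anchor z e x - anchor z e y| * (1 + ε * (|anchor z e x| + |anchor z e y|)))
        ≤ C * (|e.A| * |x - y| *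
            (1 + ε * ((|e.A| * |x| + e.noise) + (|e.A| * |y| + e.noise)))) := by
          gcongr
          exact abs_anchor_sub_le z e x y
      _ = C * |x - y| * (|e.A| * (1 + ε * (|e.A| * (|x| + |y|) + 2 * e.noise))) := by ring
  · rw [integral_const_mul]
    have := mul_le_mul_of_nonneg_left (hr (|x| + |y|) (by positivity))
      (mul_nonneg hC (abs_nonneg (x - y)))
    refine this.trans (le_of_eq ?_)
    ring

theorem LinearLipschitz.iterate_transition {E : Environment} (hE : E.MeanSquareStable) {ε r C : ℝ}
    (hε : 0 < ε) (hr0 : 0 ≤ r) (hr : ∀ s, 0 ≤ s →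
      ∫ e : Shock, |e.A| * (1 + ε * (|e.A| * s + 2 * e.noise)) ∂E.law ≤ r * (1 + ε * s))
    {f : ℝ → ℝ} (hC : 0 ≤ C) (hf : LinearLipschitz ε C f) (z : ℝ) (n : ℕ) :
    LinearLipschitz ε (C * r ^ n) ((FeasibleInterval.transition E z)^[n] f) := by
  induction n with
  | zero => simpa using hf
  | succ n ih =>
    rw [Function.iterate_succ_apply', pow_succ, ← mul_assoc]
    exact ih.transition hE hε hr (by positivity) z

section invariant

variable {E : Environment} {z : ℝ} {ψ : Measure ℝ} [IsProbabilityMeasure ψ]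

theorem AnchorInvariant.integral_transition (hψ : AnchorInvariant E z ψ) {f : ℝ → ℝ}
    (hf : Measurable f) (hi : Integrable f ψ) :
    Integrable (transition E z f) ψ ∧ ∫ x, transition E z f x ∂ψ = ∫ x, f x ∂ψ := by
  have hi' : Integrable (fun q : ℝ × Shock => f (anchor z q.2 q.1)) (ψ.prod E.law) := by
    have h := hi
    rw [← hψ, integrable_map_measure hf.aestronglyMeasurable
      (measurable_anchor z).aemeasurable] at h
    exact h
  refine ⟨hi'.integral_prod_left, ?_⟩
  conv_rhs => rw [← hψ, integral_map (measurable_anchor z).aemeasurable hf.aestronglyMeasurable]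
  exact (integral_prod _ hi').symm

theorem AnchorInvariant.integral_iterate_transition (hE : E.MeanSquareStable)
    (hψ : AnchorInvariant E z ψ) {f : ℝ → ℝ} {ε C : ℝ} (hε : 0 < ε) (hC : 0 ≤ C)
    (hf : LinearLipschitz ε C f) (hi : Integrable f ψ) {r : ℝ} (hr0 : 0 ≤ r)
    (hr : ∀ s, 0 ≤ s →
      ∫ e : Shock, |e.A| * (1 + ε * (|e.A| * s + 2 * e.noise)) ∂E.law ≤ r * (1 + ε * s)) (n : ℕ) :
    Integrable ((transition E z)^[n] f) ψ ∧
      ∫ x, (transition E z)^[n] f x ∂ψ = ∫ x, f x ∂ψ := by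
  induction n with
  | zero => exact ⟨hi, rfl⟩
  | succ n ih =>
    rw [Function.iterate_succ_apply']
    have := hψ.integral_transition
      (hf.iterate_transition hE hε hr0 hr hC z n).continuous.measurable ih.1
    exact ⟨this.1, this.2.trans ih.2⟩

/-- Convergence to equilibrium of the anchoring rule. -/
theorem AnchorInvariant.tendsto_iterate_transition (hE : E.MeanSquareStable)
    (hψ : AnchorInvariant E z ψ) (h2 : MemLp id 2 ψ) {f : ℝ → ℝ} {ε C : ℝ} (hε : 0 < ε)
    (hC : 0 ≤ C) (hf : LinearLipschitz ε C f) {r : ℝ} (hr0 : 0 ≤ r) (hr1 : r < 1)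
    (hr : ∀ s, 0 ≤ s →
      ∫ e : Shock, |e.A| * (1 + ε * (|e.A| * s + 2 * e.noise)) ∂E.law ≤ r * (1 + ε * s)) (x : ℝ) :
    Tendsto (fun n => (transition E z)^[n] f x) atTop (𝓝 (∫ y, f y ∂ψ)) := by
  obtain ⟨K, hK⟩ := hf.growth hε hC
  have hi : Integrable f ψ := integrable_comp_of_quadratic_growth h2 hf.continuous hK
  set w : ℝ → ℝ := fun y => |x - y| * (1 + ε * (|x| + |y|)) with hw
  have hwi : Integrable w ψ := by
    refine integrable_comp_of_quadratic_growth (P := id) h2 (f := w) (by fun_prop)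
      (K := (|x| + 1) * (1 + ε * (|x| + 1)) * 2) fun y => ?_
    rw [abs_of_nonneg (show 0 ≤ w y by simp only [hw]; positivity)]
    have h1 : |x - y| ≤ |x| + |y| := abs_sub _ _
    have h3 : |x| + |y| ≤ (|x| + 1) * (1 + |y|) := by
      nlinarith [mul_nonneg (abs_nonneg x) (abs_nonneg y)]
    have h4 : 1 + ε * (|x| + |y|) ≤ (1 + ε * (|x| + 1)) * (1 + |y|) := by
      nlinarith [mul_nonneg hε.le (abs_nonneg x), mul_nonneg hε.le (abs_nonneg y),
        mul_nonneg (mul_nonneg hε.le (abs_nonneg x)) (abs_nonneg y), abs_nonneg y]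
    have h5 : (1 + |y|) ^ 2 ≤ 2 * (1 + y ^ 2) := by
      nlinarith [sq_nonneg (1 - |y|), sq_abs y]
    calc w y ≤ ((|x| + 1) * (1 + |y|)) * ((1 + ε * (|x| + 1)) * (1 + |y|)) := by
          simp only [hw]
          gcongr
          exact h1.trans h3
      _ = (|x| + 1) * (1 + ε * (|x| + 1)) * (1 + |y|) ^ 2 := by ring
      _ ≤ (|x| + 1) * (1 + ε * (|x| + 1)) * (2 * (1 + y ^ 2)) := by gcongr
      _ = _ := by ring
  rw [tendsto_iff_dist_tendsto_zero]
  refine squeeze_zero (fun _ => dist_nonneg) (g := fun n => C * r ^ n * ∫ y, w y ∂ψ)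
    (fun n => ?_) ?_
  · obtain ⟨hin, hen⟩ := hψ.integral_iterate_transition hE hε hC hf hi hr0 hr n
    have hlip := hf.iterate_transition hE hε hr0 hr hC z n
    rw [Real.dist_eq, ← hen, ← integral_const_mul]
    have : (transition E z)^[n] f x - ∫ y, (transition E z)^[n] f y ∂ψ
        = ∫ y, ((transition E z)^[n] f x - (transition E z)^[n] f y) ∂ψ := by
      rw [integral_sub (integrable_const _) hin]
      simp
    rw [this]
    exact abs_integral_le_of_ae_abs_le (hwi.const_mul _) (Eventually.of_forall fun y => hlip x y)
  · have := (tendsto_pow_atTop_nhds_zero_of_lt_one hr0 hr1).const_mul (C * ∫ y, w y ∂ψ)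
    rw [mul_zero] at this
    exact this.congr fun n => by ring

end invariant

theorem eq_of_forall_lipschitz_integral_eq {μ ν : Measure ℝ} [IsProbabilityMeasure μ]
    [IsProbabilityMeasure ν]
    (h : ∀ f : ℝ → ℝ, (∃ M, ∀ x, |f x| ≤ M) → (∃ L : NNReal, LipschitzWith L f) →
      ∫ x, f x ∂μ = ∫ x, f x ∂ν) : μ = ν := by
  set m : ProbabilityMeasure ℝ := ⟨μ, inferInstance⟩ with hm
  set n : ProbabilityMeasure ℝ := ⟨ν, inferInstance⟩ with hn
  have key : Tendsto (fun _ : ℕ => m) atTop (𝓝 n) := by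
    rw [tendsto_iff_forall_lipschitz_integral_tendsto]
    rintro f ⟨C, hC⟩ hL
    have hb : ∃ M, ∀ x, |f x| ≤ M := ⟨C + |f 0|, fun x => by
      have h1 := hC x 0
      rw [Real.dist_eq] at h1
      have := abs_add_le (f x - f 0) (f 0)
      rw [sub_add_cancel] at this
      linarith⟩
    have he : ∫ x, f x ∂(m : Measure ℝ) = ∫ x, f x ∂(n : Measure ℝ) := h f hb hL
    rw [he]
    exact tendsto_const_nhds
  have hmn : m = n := tendsto_nhds_unique tendsto_const_nhds key
  exact congrArg Subtype.val hmn

/-- No moment assumption on the second invariant law is needed. -/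
theorem AnchorInvariant.eq_stationaryLaw {E : Environment} (hE : E.MeanSquareStable) {z : ℝ}
    {ψ : Measure ℝ} [IsProbabilityMeasure ψ] (hψ : AnchorInvariant E z ψ) :
    ψ = stationaryLaw E z := by
  obtain ⟨ε, r, hε, hr0, hr1, hr⟩ := hE.exists_weight
  refine eq_of_forall_lipschitz_integral_eq fun f ⟨M, hM⟩ ⟨L, hL⟩ => ?_
  have hf : LinearLipschitz ε L f := fun x y => by
    have := hL.dist_le_mul x y
    rw [Real.dist_eq, Real.dist_eq] at this
    refine this.trans ?_
    gcongr
    exact le_mul_of_one_le_right (abs_nonneg _) (le_add_of_nonneg_right (by positivity))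
  have hi : Integrable f ψ :=
    (integrable_const M).mono' hf.continuous.aestronglyMeasurable (Eventually.of_forall hM)
  have hbound : ∀ n x, |(transition E z)^[n] f x| ≤ M := by
    intro n
    induction n with
    | zero => exact hM
    | succ n ih =>
      intro x
      rw [Function.iterate_succ_apply']
      refine (abs_integral_le_of_ae_abs_le (μ := E.law) (integrable_const M)
        (Eventually.of_forall fun e : Shock => ih (anchor z e x))).trans (le_of_eq ?_)
      simp
  have hlim := tendsto_integral_of_dominated_convergence (μ := ψ) (fun _ => M)
    (fun n => (hf.iterate_transition hE hε hr0 hr L.2 z n).continuous.aestronglyMeasurable)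
    (integrable_const M) (fun n => Eventually.of_forall (hbound n))
    (Eventually.of_forall fun x => (hE.anchorInvariant_stationaryLaw z).tendsto_iterate_transition
      hE (hE.memLp_stationaryLaw z) hε L.2 hf hr0 hr1 hr x)
  have hconst : ∀ n, ∫ x, (transition E z)^[n] f x ∂ψ = ∫ x, f x ∂ψ := fun n =>
    (hψ.integral_iterate_transition hE hε L.2 hf hi hr0 hr n).2
  simp only [hconst] at hlim
  have := tendsto_nhds_unique hlim tendsto_const_nhds
  simpa using this.symm

/-! ### Path laws as sequences of feasible periods -/

section pathLaw

variable (E : Environment) (π : Policy) (ρ : Measure ℝ)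

/-- Period `0` of a path started at `p`. -/
def initialObs (p : ℝ) : Obs := ((p, p), p)

@[fun_prop]
theorem measurable_initialObs : Measurable initialObs := by
  unfold initialObs; fun_prop

theorem pathLaw_eq_trajMeasure :
    pathLaw E π ρ = Kernel.trajMeasure (X := fun _ => Obs) (ρ.map initialObs) (stepKernel E π) := by
  unfold pathLaw Kernel.trajMeasure
  rw [Measure.map_map (by fun_prop) (by fun_prop)]
  rfl

variable [IsProbabilityMeasure ρ]

instance : IsProbabilityMeasure (pathLaw E π ρ) := by
  have : IsProbabilityMeasure (ρ.map initialObs) :=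
    Measure.isProbabilityMeasure_map measurable_initialObs.aemeasurable
  rw [pathLaw_eq_trajMeasure]
  infer_instance

/-- The history up to period `n` along a path. -/
def historyAt (n : ℕ) (x : ℕ → Obs) : History n := fun i => x i

@[fun_prop]
theorem measurable_historyAt (n : ℕ) : Measurable (historyAt n) := by
  unfold historyAt; fun_prop

@[fun_prop]
theorem measurable_lastAction (n : ℕ) : Measurable (History.lastAction (n := n)) := by
  unfold History.lastAction; fun_prop

theorem pathLaw_map_history_succ (n : ℕ) :
    (pathLaw E π ρ).map (fun x => (historyAt n x, x (n + 1))) =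
      (pathLaw E π ρ).map (historyAt n) ⊗ₘ stepKernel E π n := by
  have : IsProbabilityMeasure (ρ.map initialObs) :=
    Measure.isProbabilityMeasure_map measurable_initialObs.aemeasurable
  rw [pathLaw_eq_trajMeasure]
  exact Kernel.map_frestrictLe_trajMeasure_compProd_eq_map_trajMeasure.symm

theorem compProd_intervalKernel (n : ℕ) (μ : Measure (History n)) [IsProbabilityMeasure μ] :
    μ ⊗ₘ intervalKernel E n =
      (μ.prod E.law).map fun q => (q.1, q.2.interval q.1.lastAction) := by
  have hm := measurable_interval_lastAction n
  refine Measure.ext_of_lintegral _ fun f hf => ?_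
  rw [Measure.lintegral_compProd hf, lintegral_map hf (measurable_fst.prodMk hm)]
  refine Eq.trans (lintegral_congr fun h => ?_)
    (lintegral_prod _ (hf.comp (measurable_fst.prodMk hm)).aemeasurable).symm
  have hfh : Measurable fun b => f (h, b) := hf.comp (by fun_prop)
  rw [intervalKernel, Kernel.map_apply _ hm, lintegral_map hfh hm, Kernel.prod_apply,
    Kernel.id_apply, Kernel.const_apply]
  refine (lintegral_prod _ (hfh.comp hm).aemeasurable).trans ?_
  exact lintegral_dirac' _ (Measurable.lintegral_prod_right' (hfh.comp hm))

theorem pathLaw_map_history_interval (n : ℕ) :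
    (pathLaw E π ρ).map (fun x => (historyAt n x, (x (n + 1)).1)) =
      (((pathLaw E π ρ).map (historyAt n)).prod E.law).map
        fun q => (q.1, q.2.interval q.1.lastAction) := by
  have : IsProbabilityMeasure ((pathLaw E π ρ).map (historyAt n)) :=
    Measure.isProbabilityMeasure_map (measurable_historyAt n).aemeasurable
  rw [← compProd_intervalKernel]
  have h1 : (fun x : ℕ → Obs => (historyAt n x, (x (n + 1)).1)) =
      Prod.map id Prod.fst ∘ fun x => (historyAt n x, x (n + 1)) := rfl
  rw [h1, ← Measure.map_map (by fun_prop) (by fun_prop), pathLaw_map_history_succ,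
    ← Measure.compProd_map measurable_fst, ← Kernel.fst_eq, stepKernel, Kernel.fst_compProd]

theorem pathLaw_map_action_interval (n : ℕ) :
    (pathLaw E π ρ).map (fun x => ((x n).2, (x (n + 1)).1)) =
      (((pathLaw E π ρ).map fun x => (x n).2).prod E.law).map
        fun q => (q.1, q.2.interval q.1) := by
  have : IsProbabilityMeasure ((pathLaw E π ρ).map (historyAt n)) :=
    Measure.isProbabilityMeasure_map (measurable_historyAt n).aemeasurable
  have h1 : (fun x : ℕ → Obs => ((x n).2, (x (n + 1)).1)) =
      Prod.map History.lastAction id ∘ fun x => (historyAt n x, (x (n + 1)).1) := rfl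
  have h2 : ((pathLaw E π ρ).map fun x => (x n).2) =
      ((pathLaw E π ρ).map (historyAt n)).map History.lastAction := by
    rw [Measure.map_map (by fun_prop) (by fun_prop)]
    rfl
  have hm := measurable_interval_lastAction n
  rw [h1, ← Measure.map_map (by fun_prop) (by fun_prop), pathLaw_map_history_interval,
    Measure.map_map (by fun_prop) (measurable_fst.prodMk hm), h2]
  have h3 : (((pathLaw E π ρ).map (historyAt n)).map History.lastAction).prod E.law =
      (((pathLaw E π ρ).map (historyAt n)).prod E.law).map (Prod.map History.lastAction id) := by
    rw [← Measure.map_prod_map _ _ (measurable_lastAction n) measurable_id, Measure.map_id]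
  rw [h3, Measure.map_map (by fun_prop) (by fun_prop)]
  rfl

theorem pathLaw_map_action_zero : (pathLaw E π ρ).map (fun x => (x 0).2) = ρ := by
  have : IsProbabilityMeasure (ρ.map initialObs) :=
    Measure.isProbabilityMeasure_map measurable_initialObs.aemeasurable
  have h1 : (fun x : ℕ → Obs => (x 0).2) = History.lastAction ∘ historyAt 0 := rfl
  rw [h1, ← Measure.map_map (by fun_prop) (by fun_prop)]
  have h2 : (pathLaw E π ρ).map (historyAt 0) =
      ρ.map (fun p : ℝ => (fun _ => ((p, p), p) : History 0)) := by
    have h3 : (pathLaw E π ρ).map (historyAt 0) =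
        Measure.bind (ρ.map (fun p : ℝ => (fun _ => ((p, p), p) : History 0)))
          ((Kernel.traj (X := fun _ => Obs) (stepKernel E π) 0).map
            (Preorder.frestrictLe (π := fun _ => Obs) 0)) := by
      unfold pathLaw
      exact Measure.map_comp _ _ (by fun_prop)
    rw [h3, Kernel.traj_map_frestrictLe, Kernel.partialTraj_self, Measure.id_comp]
  rw [h2, Measure.map_map (by fun_prop) (by fun_prop)]
  exact Measure.map_id

theorem Admissible.feasibleStep {E : Environment} {π : Policy} {ρ : Measure ℝ}
    [IsProbabilityMeasure ρ] (h : Admissible E π ρ) (t : ℕ) :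
    FeasibleStep E (pathLaw E π ρ) (fun x => (x t).2) (fun x => (x (t + 1)).1)
      (fun x => (x (t + 1)).2) where
  measurable_prev := by fun_prop
  measurable_interval := by fun_prop
  measurable_next := by fun_prop
  map_eq := pathLaw_map_action_interval E π ρ t
  mem := h t

theorem ae_anchoring_action_eq (z : ℝ) (t : ℕ) :
    ∀ᵐ x ∂pathLaw E (anchoring z) ρ, (x (t + 1)).2 = proj (x (t + 1)).1 z := by
  have hm : Measurable fun x : ℕ → Obs => (historyAt t x, x (t + 1)) := by fun_prop
  have hs : MeasurableSet {q : History t × Obs | q.2.2 = proj q.2.1 z} :=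
    measurableSet_eq_fun (by fun_prop) ((measurable_proj_left z).comp (by fun_prop))
  have key : ∀ᵐ q ∂(pathLaw E (anchoring z) ρ).map (fun x => (historyAt t x, x (t + 1))),
      q.2.2 = proj q.2.1 z := by
    rw [pathLaw_map_history_succ]
    refine (Measure.ae_compProd_iff hs).2 (Eventually.of_forall fun h => ?_)
    have hs' : MeasurableSet {o : Obs | o.2 = proj o.1 z} :=
      measurableSet_eq_fun (by fun_prop) ((measurable_proj_left z).comp (by fun_prop))
    refine (Kernel.ae_compProd_iff hs').2 (Eventually.of_forall fun I => ?_)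
    change ∀ᵐ y ∂(Kernel.deterministic (fun q : History t × (ℝ × ℝ) => proj q.2 z)
      (measurable_proj z t)) (h, I), y = proj I z
    rw [Kernel.deterministic_apply, ae_dirac_iff (measurableSet_eq_fun (by fun_prop) (by fun_prop))]
  exact ae_of_ae_map hm.aemeasurable key

theorem ae_interval_le_of_pathLaw (t : ℕ) :
    ∀ᵐ x ∂pathLaw E π ρ, (x (t + 1)).1.1 ≤ (x (t + 1)).1.2 := by
  have : IsProbabilityMeasure ((pathLaw E π ρ).map fun x => (x t).2) :=
    Measure.isProbabilityMeasure_map (Measurable.aemeasurable (by fun_prop))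
  have hm : Measurable fun x : ℕ → Obs => ((x t).2, (x (t + 1)).1) := by fun_prop
  have hm' : Measurable fun q : ℝ × Shock => (q.1, q.2.interval q.1) := by fun_prop
  have hs : MeasurableSet {q : ℝ × ℝ × ℝ | q.2.1 ≤ q.2.2} :=
    measurableSet_le (by fun_prop) (by fun_prop)
  have key : ∀ᵐ q ∂(pathLaw E π ρ).map (fun x => ((x t).2, (x (t + 1)).1)), q.2.1 ≤ q.2.2 := by
    rw [pathLaw_map_action_interval]
    refine (ae_map_iff hm'.aemeasurable hs).2 ?_
    filter_upwards [E.ae_prod_base_nonempty ((pathLaw E π ρ).map fun x => (x t).2)] with q hq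
    exact interval_fst_le_snd hq _
  exact ae_of_ae_map hm.aemeasurable key

/-- The anchoring rule is admissible from every initial law. -/
theorem admissible_anchoring (z : ℝ) : Admissible E (anchoring z) ρ := fun t => by
  filter_upwards [ae_anchoring_action_eq E ρ z t, ae_interval_le_of_pathLaw E (anchoring z) ρ t]
    with x h1 h2
  rw [h1]
  exact proj_mem h2 z

end pathLaw

/-- The law of the next action when the target `z` is projected. -/
theorem FeasibleStep.map_next_of_ae_eq_proj {E : Environment} {Ω : Type*} [MeasurableSpace Ω]
    {μ : Measure Ω} {P : Ω → ℝ} {I : Ω → ℝ × ℝ} {P' : Ω → ℝ} (S : FeasibleStep E μ P I P') {z : ℝ}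
    (h : ∀ᵐ ω ∂μ, P' ω = proj (I ω) z) :
    μ.map P' = ((μ.map P).prod E.law).map fun q => anchor z q.2 q.1 := by
  have hm : Measurable fun q : ℝ × ℝ × ℝ => proj q.2 z :=
    (measurable_proj_left z).comp measurable_snd
  have h1 := congrArg (Measure.map fun q : ℝ × ℝ × ℝ => proj q.2 z) S.map_eq
  rw [Measure.map_map hm (S.measurable_prev.prodMk S.measurable_interval),
    Measure.map_map hm (by fun_prop)] at h1
  rw [Measure.map_congr h]
  exact h1

section stationaryIff

variable {E : Environment} {π : Policy} {z : ℝ} {ψ : Measure ℝ}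

theorem IsStationary.anchorInvariant (H : IsStationary E π ψ)
    (h : ∀ᵐ x ∂pathLaw E π ψ, (x 1).2 = proj (x 1).1 z) : AnchorInvariant E z ψ := by
  have := H.isProb
  have h1 := (H.admissible.feasibleStep 0).map_next_of_ae_eq_proj h
  rw [H.law_action 0, H.law_action 1] at h1
  exact h1.symm

theorem isStationary_anchoring_iff [IsProbabilityMeasure ψ] :
    IsStationary E (anchoring z) ψ ↔ AnchorInvariant E z ψ := by
  refine ⟨fun H => H.anchorInvariant (ae_anchoring_action_eq E ψ z 0), fun H =>
    ⟨inferInstance, admissible_anchoring E ψ z, fun t => ?_⟩⟩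
  induction t with
  | zero => exact pathLaw_map_action_zero E _ ψ
  | succ t ih =>
    rw [((admissible_anchoring E ψ z).feasibleStep t).map_next_of_ae_eq_proj
      (ae_anchoring_action_eq E ψ z t), ih]
    exact H

end stationaryIff

/-! ### Stationary and long-run average cost -/

section secondMoments

theorem integrable_sq_sub {Ω : Type*} [MeasurableSpace Ω] {μ : Measure Ω} [IsFiniteMeasure μ]
    {P : Ω → ℝ} (hP : MemLp P 2 μ) (c : ℝ) : Integrable (fun ω => (P ω - c) ^ 2) μ :=
  (hP.sub (memLp_const c)).integrable_sq

variable {ψ : Measure ℝ} [IsProbabilityMeasure ψ]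

theorem integral_sq_sub (h : MemLp id 2 ψ) (c : ℝ) :
    ∫ x, (x - c) ^ 2 ∂ψ = ∫ x, x ^ 2 ∂ψ - 2 * c * ∫ x, x ∂ψ + c ^ 2 := by
  have h1 : Integrable (fun x : ℝ => x) ψ := h.integrable one_le_two
  have h2 : Integrable (fun x : ℝ => x ^ 2) ψ := h.integrable_sq
  calc ∫ x, (x - c) ^ 2 ∂ψ = ∫ x, (x ^ 2 + (-(2 * c) * x + c ^ 2)) ∂ψ := by
        congr 1; ext x; ring
    _ = ∫ x, x ^ 2 ∂ψ + (-(2 * c) * ∫ x, x ∂ψ + c ^ 2) := by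
        have h3 : Integrable (fun x : ℝ => -(2 * c) * x + c ^ 2) ψ :=
          (h1.const_mul _).add (integrable_const _)
        rw [integral_add h2 h3, integral_add (h1.const_mul _) (integrable_const _),
          integral_const_mul]
        simp
    _ = _ := by ring

theorem integral_sq_sub_eq_add (h : MemLp id 2 ψ) (c : ℝ) :
    ∫ x, (x - c) ^ 2 ∂ψ =
      ∫ x, (x - ∫ y, y ∂ψ) ^ 2 ∂ψ + (∫ y, y ∂ψ - c) ^ 2 := by
  rw [integral_sq_sub h, integral_sq_sub h]
  ring

theorem evariance_id_eq (h : MemLp id 2 ψ) :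
    evariance id ψ = ENNReal.ofReal (∫ x, (x - ∫ y, y ∂ψ) ^ 2 ∂ψ) := by
  rw [← ofReal_variance h, variance_eq_integral (by fun_prop)]
  rfl

end secondMoments

namespace FeasibleStep

variable {E : Environment} {Ω : Type*} [MeasurableSpace Ω] {μ : Measure Ω}
  [IsProbabilityMeasure μ] {P : Ω → ℝ} {I : Ω → ℝ × ℝ} {P' : Ω → ℝ}
  {c cost z : ℝ} {h : ℝ → ℝ}

theorem integral_total_next_of_map_eq (S : FeasibleStep E μ P I P')
    (hP : MemLp P 2 μ) (H : IsRelativeValue E c cost h) (heq : μ.map P' = μ.map P) :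
    ∫ ω, ((P' ω - c) ^ 2 + h (P' ω)) ∂μ = ∫ ω, (P ω - c) ^ 2 ∂μ + ∫ ω, h (P ω) ∂μ := by
  obtain ⟨K, hK⟩ := H.growth
  have hg := H.continuous_total.aestronglyMeasurable (μ := μ.map P')
  rw [← integral_map (φ := P') (f := fun y => (y - c) ^ 2 + h y)
    S.measurable_next.aemeasurable hg, heq, integral_map S.measurable_prev.aemeasurable
    (heq ▸ hg), integral_add (integrable_sq_sub hP c)
    (integrable_comp_of_quadratic_growth hP H.continuous hK)]

/-- In a stationary regime the optimality inequality bounds the mean squared distance to the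
center. -/
theorem cost_le_of_map_eq (S : FeasibleStep E μ P I P') (hE : E.MeanSquareStable)
    (hP : MemLp P 2 μ) (H : IsRelativeValue E c cost h)
    (hz : ∀ y, (z - c) ^ 2 + h z ≤ (y - c) ^ 2 + h y) (heq : μ.map P' = μ.map P) :
    cost ≤ ∫ ω, (P ω - c) ^ 2 ∂μ := by
  have h1 := S.cost_add_le hE hP H hz
  rw [S.integral_total_next_of_map_eq hP H heq] at h1
  linarith

theorem ae_eq_proj_of_map_eq (S : FeasibleStep E μ P I P') (hE : E.MeanSquareStable)
    (hP : MemLp P 2 μ) (H : IsRelativeValue E c cost h)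
    (hz : ∀ y, (z - c) ^ 2 + h z ≤ (y - c) ^ 2 + h y) (heq : μ.map P' = μ.map P)
    (hle : ∫ ω, (P ω - c) ^ 2 ∂μ ≤ cost) : ∀ᵐ ω ∂μ, P' ω = proj (I ω) z := by
  refine S.ae_eq_proj hE hP H hz ?_
  rw [S.integral_total_next_of_map_eq hP H heq]
  linarith

end FeasibleStep

section stationary

variable {E : Environment} {π : Policy} {ψ : Measure ℝ} {c cost z : ℝ} {h : ℝ → ℝ}

theorem IsStationary.memLp_action (Hψ : IsStationary E π ψ) (h2 : MemLp id 2 ψ) (t : ℕ) :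
    MemLp (fun x : ℕ → Obs => (x t).2) 2 (pathLaw E π ψ) := by
  have h1 := h2
  rw [← Hψ.law_action t, memLp_map_measure_iff (by fun_prop)
    (Measurable.aemeasurable (by fun_prop))] at h1
  exact h1

theorem IsStationary.integral_sq_sub_action (Hψ : IsStationary E π ψ) (c : ℝ) (t : ℕ) :
    ∫ x, ((x t).2 - c) ^ 2 ∂pathLaw E π ψ = ∫ y, (y - c) ^ 2 ∂ψ := by
  conv_rhs => rw [← Hψ.law_action t]
  rw [integral_map (Measurable.aemeasurable (by fun_prop))
    (Measurable.aestronglyMeasurable (by fun_prop))]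

theorem IsStationary.cost_le (Hψ : IsStationary E π ψ) (hE : E.MeanSquareStable)
    (h2 : MemLp id 2 ψ) (H : IsRelativeValue E c cost h)
    (hz : ∀ y, (z - c) ^ 2 + h z ≤ (y - c) ^ 2 + h y) :
    cost ≤ ∫ x, (x - c) ^ 2 ∂ψ := by
  have := Hψ.isProb
  rw [← Hψ.integral_sq_sub_action c 0]
  exact (Hψ.admissible.feasibleStep 0).cost_le_of_map_eq hE (Hψ.memLp_action h2 0) H hz
    ((Hψ.law_action 1).trans (Hψ.law_action 0).symm)

theorem IsStationary.ae_eq_proj (Hψ : IsStationary E π ψ) (hE : E.MeanSquareStable)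
    (h2 : MemLp id 2 ψ) (H : IsRelativeValue E c cost h)
    (hz : ∀ y, (z - c) ^ 2 + h z ≤ (y - c) ^ 2 + h y)
    (hle : ∫ x, (x - c) ^ 2 ∂ψ ≤ cost) (t : ℕ) :
    ∀ᵐ x ∂pathLaw E π ψ, (x (t + 1)).2 = proj (x (t + 1)).1 z := by
  have := Hψ.isProb
  rw [← Hψ.integral_sq_sub_action c t] at hle
  exact (Hψ.admissible.feasibleStep t).ae_eq_proj_of_map_eq hE (Hψ.memLp_action h2 t) H hz
    ((Hψ.law_action (t + 1)).trans (Hψ.law_action t).symm) hle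

variable [IsProbabilityMeasure ψ]

theorem AnchorInvariant.isStationary (hψ : AnchorInvariant E z ψ) :
    IsStationary E (anchoring z) ψ := isStationary_anchoring_iff.2 hψ

theorem AnchorInvariant.integral_sq_le (hψ : AnchorInvariant E z ψ) (hE : E.MeanSquareStable)
    (h2 : MemLp id 2 ψ) {a C : ℝ} (ha : 0 ≤ a) (ha1 : a < 1) (hC : 0 ≤ C)
    (haC : ∀ s : ℝ, ∫ e : Shock, (|e.A| * s + e.noise) ^ 2 ∂E.law ≤ a * s ^ 2 + C) :
    ∫ x, x ^ 2 ∂ψ ≤ C / (1 - a) := by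
  have Hψ := hψ.isStationary
  have := (Hψ.admissible.feasibleStep 0).integral_sq_next_le hE (Hψ.memLp_action h2 0) ha hC haC
  have h0 := Hψ.integral_sq_sub_action 0 0
  have h1 := Hψ.integral_sq_sub_action 0 1
  simp only [sub_zero] at h0 h1
  rw [zero_add, h0, h1] at this
  rw [le_div_iff₀ (by linarith)]
  linarith

/-- The anchoring rule at the unconstrained minimizer attains the optimal average cost. -/
theorem AnchorInvariant.integral_sq_sub_eq_cost (hψ : AnchorInvariant E z ψ)
    (hE : E.MeanSquareStable) (h2 : MemLp id 2 ψ) (H : IsRelativeValue E c cost h)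
    (hz : ∀ y, (z - c) ^ 2 + h z ≤ (y - c) ^ 2 + h y) :
    ∫ x, (x - c) ^ 2 ∂ψ = cost := by
  have Hψ := hψ.isStationary
  have S := Hψ.admissible.feasibleStep 0
  have hP := Hψ.memLp_action h2 0
  have h1 := S.integral_total_proj hE hP H hz
  have h3 := S.integral_total_next_of_map_eq hP H
    ((Hψ.law_action 1).trans (Hψ.law_action 0).symm)
  have h4 : ∫ x, (((x (0 + 1)).2 - c) ^ 2 + h (x (0 + 1)).2) ∂pathLaw E (anchoring z) ψ =
      ∫ x, ((proj (x (0 + 1)).1 z - c) ^ 2 + h (proj (x (0 + 1)).1 z))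
        ∂pathLaw E (anchoring z) ψ := by
    refine integral_congr_ae ?_
    filter_upwards [ae_anchoring_action_eq E ψ z 0] with x hx
    rw [hx]
  rw [← Hψ.integral_sq_sub_action c 0]
  linarith

end stationary

section longRun

variable {E : Environment} {π : Policy} {ρ : Measure ℝ} [IsProbabilityMeasure ρ]
  {c cost z : ℝ} {h : ℝ → ℝ}

theorem Admissible.memLp_action (hadm : Admissible E π ρ) (hE : E.MeanSquareStable)
    (h2 : MemLp id 2 ρ) (t : ℕ) : MemLp (fun x : ℕ → Obs => (x t).2) 2 (pathLaw E π ρ) := by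
  induction t with
  | zero =>
    rw [← pathLaw_map_action_zero E π ρ, memLp_map_measure_iff (by fun_prop)
      (Measurable.aemeasurable (by fun_prop))] at h2
    exact h2
  | succ t ih => exact (hadm.feasibleStep t).memLp_next hE ih

theorem Admissible.exists_integral_sq_le (hadm : Admissible E π ρ) (hE : E.MeanSquareStable)
    (h2 : MemLp id 2 ρ) : ∃ M, ∀ t, ∫ x, (x t).2 ^ 2 ∂pathLaw E π ρ ≤ M := by
  obtain ⟨a, C, ha0, ha1, hC, haC⟩ := hE.exists_sq_drift
  refine ⟨∫ x, (x 0).2 ^ 2 ∂pathLaw E π ρ + C / (1 - a), fun t => ?_⟩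
  have ha' : 0 < 1 - a := by linarith
  have hs : 0 ≤ ∫ x, (x 0).2 ^ 2 ∂pathLaw E π ρ := integral_nonneg fun x => sq_nonneg _
  induction t with
  | zero => exact le_add_of_nonneg_right (by positivity)
  | succ t ih =>
    have := (hadm.feasibleStep t).integral_sq_next_le hE (hadm.memLp_action hE h2 t) ha0 hC haC
    have h3 : a * (C / (1 - a)) + C = C / (1 - a) := by field_simp; ring
    nlinarith [mul_le_mul_of_nonneg_left ih ha0]

theorem Admissible.exists_abs_integral_le (hadm : Admissible E π ρ) (hE : E.MeanSquareStable)
    (h2 : MemLp id 2 ρ) {f : ℝ → ℝ} {K : ℝ} (hK : ∀ x, |f x| ≤ K * (1 + x ^ 2)) :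
    ∃ B, ∀ t, |∫ x, f (x t).2 ∂pathLaw E π ρ| ≤ B := by
  obtain ⟨M, hM⟩ := hadm.exists_integral_sq_le hE h2
  have hK0 : 0 ≤ K := by
    have := (abs_nonneg _).trans (hK 0)
    simpa using this
  refine ⟨K * (1 + M), fun t => ?_⟩
  have hi := (hadm.memLp_action hE h2 t).integrable_sq
  have hi' : Integrable (fun x : ℕ → Obs => 1 + (x t).2 ^ 2) (pathLaw E π ρ) :=
    (integrable_const 1).add hi
  refine (abs_integral_le_of_ae_abs_le (hi'.const_mul K)
    (Eventually.of_forall fun x => hK _)).trans ?_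
  rw [integral_const_mul, integral_add (integrable_const _) hi]
  refine mul_le_mul_of_nonneg_left ?_ hK0
  simpa using hM t

theorem Admissible.longRunMSE_eq (hadm : Admissible E π ρ) (hE : E.MeanSquareStable)
    (h2 : MemLp id 2 ρ) (c : ℝ) :
    longRunMSE E π ρ c = limsup (fun T : ℕ => ENNReal.ofReal ((∑ t ∈ Finset.range T,
      ∫ x, ((x (t + 1)).2 - c) ^ 2 ∂pathLaw E π ρ) / T)) atTop := by
  unfold longRunMSE
  refine limsup_congr ?_
  filter_upwards [eventually_gt_atTop 0] with T hT
  have hT' : (0 : ℝ) < T := by exact_mod_cast hT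
  rw [ENNReal.ofReal_div_of_pos hT', ENNReal.ofReal_natCast,
    ENNReal.ofReal_sum_of_nonneg fun t _ => integral_nonneg fun x => sq_nonneg _]
  congr 1
  refine Finset.sum_congr rfl fun t _ => ?_
  rw [ofReal_integral_eq_lintegral_ofReal
    (integrable_sq_sub (hadm.memLp_action hE h2 (t + 1)) c)
    (Eventually.of_forall fun x => sq_nonneg _)]

theorem tendsto_ofReal_add_div (v B : ℝ) :
    Tendsto (fun T : ℕ => ENNReal.ofReal (v + B / T)) atTop (𝓝 (ENNReal.ofReal v)) := by
  refine ENNReal.tendsto_ofReal ?_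
  simpa using tendsto_const_nhds.add (tendsto_const_div_atTop_nhds_zero_nat B)

theorem Admissible.integral_total_action (hadm : Admissible E π ρ) (hE : E.MeanSquareStable)
    (h2 : MemLp id 2 ρ) (H : IsRelativeValue E c cost h) (t : ℕ) :
    ∫ x, (((x t).2 - c) ^ 2 + h (x t).2) ∂pathLaw E π ρ =
      ∫ x, ((x t).2 - c) ^ 2 ∂pathLaw E π ρ + ∫ x, h (x t).2 ∂pathLaw E π ρ := by
  obtain ⟨K, hK⟩ := H.growth
  have hP := hadm.memLp_action hE h2 t
  exact integral_add (integrable_sq_sub hP c)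
    (integrable_comp_of_quadratic_growth hP H.continuous hK)

/-- Telescoping the optimality inequality along a path: no admissible policy has a smaller long-run
mean squared error than the optimal average cost. -/
theorem Admissible.cost_le_longRunMSE (hadm : Admissible E π ρ) (hE : E.MeanSquareStable)
    (h2 : MemLp id 2 ρ) (H : IsRelativeValue E c cost h)
    (hz : ∀ y, (z - c) ^ 2 + h z ≤ (y - c) ^ 2 + h y) :
    ENNReal.ofReal cost ≤ longRunMSE E π ρ c := by
  obtain ⟨K, hK⟩ := H.growth
  obtain ⟨B, hB⟩ := hadm.exists_abs_integral_le hE h2 hK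
  have hsum : ∀ T : ℕ, T * cost + ∫ x, h (x 0).2 ∂pathLaw E π ρ ≤
      (∑ t ∈ Finset.range T, ∫ x, ((x (t + 1)).2 - c) ^ 2 ∂pathLaw E π ρ) +
        ∫ x, h (x T).2 ∂pathLaw E π ρ := by
    intro T
    induction T with
    | zero => simp
    | succ T ih =>
      have h1 := (hadm.feasibleStep T).cost_add_le hE (hadm.memLp_action hE h2 T) H hz
      rw [hadm.integral_total_action hE h2 H] at h1
      rw [Finset.sum_range_succ]
      push_cast
      linarith
  rw [hadm.longRunMSE_eq hE h2, ← (tendsto_ofReal_add_div cost (-(2 * B))).limsup_eq]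
  refine limsup_le_limsup ?_
  filter_upwards [eventually_gt_atTop 0] with T hT
  have hT' : (0 : ℝ) < T := by exact_mod_cast hT
  refine ENNReal.ofReal_le_ofReal ?_
  rw [le_div_iff₀ hT', add_mul, div_mul_cancel₀ _ hT'.ne']
  linarith [hsum T, abs_le.1 (hB 0), abs_le.1 (hB T)]

theorem longRunMSE_anchoring_le (hE : E.MeanSquareStable)
    (h2 : MemLp id 2 ρ) (H : IsRelativeValue E c cost h)
    (hz : ∀ y, (z - c) ^ 2 + h z ≤ (y - c) ^ 2 + h y) :
    longRunMSE E (anchoring z) ρ c ≤ ENNReal.ofReal cost := by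
  have hadm := admissible_anchoring E ρ z
  obtain ⟨K, hK⟩ := H.growth
  obtain ⟨B, hB⟩ := hadm.exists_abs_integral_le hE h2 hK
  have hsum : ∀ T : ℕ, (∑ t ∈ Finset.range T,
      ∫ x, ((x (t + 1)).2 - c) ^ 2 ∂pathLaw E (anchoring z) ρ) +
        ∫ x, h (x T).2 ∂pathLaw E (anchoring z) ρ =
      T * cost + ∫ x, h (x 0).2 ∂pathLaw E (anchoring z) ρ := by
    intro T
    induction T with
    | zero => simp
    | succ T ih =>
      have h1 := (hadm.feasibleStep T).integral_total_proj hE (hadm.memLp_action hE h2 T) H hz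
      have h4 : ∫ x, (((x (T + 1)).2 - c) ^ 2 + h (x (T + 1)).2) ∂pathLaw E (anchoring z) ρ =
          ∫ x, ((proj (x (T + 1)).1 z - c) ^ 2 + h (proj (x (T + 1)).1 z))
            ∂pathLaw E (anchoring z) ρ := by
        refine integral_congr_ae ?_
        filter_upwards [ae_anchoring_action_eq E ρ z T] with x hx
        rw [hx]
      rw [← h4, hadm.integral_total_action hE h2 H] at h1
      rw [Finset.sum_range_succ]
      push_cast
      linarith
  rw [hadm.longRunMSE_eq hE h2, ← (tendsto_ofReal_add_div cost (2 * B)).limsup_eq]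
  refine limsup_le_limsup ?_
  filter_upwards [eventually_gt_atTop 0] with T hT
  have hT' : (0 : ℝ) < T := by exact_mod_cast hT
  refine ENNReal.ofReal_le_ofReal ?_
  rw [div_le_iff₀ hT', add_mul, div_mul_cancel₀ _ hT'.ne']
  linarith [hsum T, abs_le.1 (hB 0), abs_le.1 (hB T)]

end longRun

/-! ### Uniqueness of the target and of the center -/

/-- A function that is at each `c` the least of the mean squared errors `s - 2 c m + c²` of a family
of laws with bounded means `m` and second moments `s` attains its minimum. -/
theorem exists_forall_le_of_moment_family {f s m : ℝ → ℝ} {R : ℝ} (hs0 : ∀ c, 0 ≤ s c)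
    (hs : ∀ c, s c ≤ R) (hm : ∀ c, |m c| ≤ R)
    (hle : ∀ c c', f c ≤ s c' - 2 * c * m c' + c ^ 2)
    (heq : ∀ c, f c = s c - 2 * c * m c + c ^ 2) : ∃ c₀, ∀ c, f c₀ ≤ f c := by
  have hR : 0 ≤ R := (hs0 0).trans (hs 0)
  have hone : ∀ c c', f c - f c' ≤ |c - c'| * (2 * R + (|c| + |c'|)) := by
    intro c c'
    have h1 := hle c c'
    have h2 := heq c'
    have h3 : f c - f c' ≤ (c - c') * (c + c' - 2 * m c') := by linarith
    refine h3.trans ((le_abs_self _).trans ?_)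
    rw [abs_mul]
    gcongr
    have h4 := abs_sub (c + c') (2 * m c')
    have h5 := abs_add_le c c'
    rw [abs_mul, abs_two] at h4
    linarith [hm c']
  have hlip : LinearLipschitz (1 / (2 * R + 1)) (2 * R + 1) f := fun x y => by
    have h0 : (2 * R + 1) * (|x - y| * (1 + 1 / (2 * R + 1) * (|x| + |y|))) =
        |x - y| * (2 * R + 1 + (|x| + |y|)) := by
      field_simp
    have h1 := hone x y
    have h2 := hone y x
    rw [abs_sub_comm y x, add_comm |y|] at h2
    rw [h0, abs_le]
    have h3 := abs_nonneg (x - y)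
    constructor <;> nlinarith
  refine hlip.continuous.exists_forall_le' 0 ?_
  filter_upwards [(isCompact_closedBall (0 : ℝ) (2 * R + 1)).compl_mem_cocompact] with c hc
  have hc' : 2 * R + 1 < |c| := by simpa [Real.dist_eq] using hc
  have h1 : c * m c ≤ |c| * R := (le_abs_self _).trans (by rw [abs_mul]; gcongr; exact hm c)
  rw [heq 0, heq c]
  have h2 := hs0 c
  have h3 := hs 0
  have h4 := sq_abs c
  nlinarith

theorem exists_linearLipschitz_of_convexOn {h : ℝ → ℝ} (hh : ConvexOn ℝ univ h) {K : ℝ}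
    (hK : ∀ x, |h x| ≤ K * (1 + x ^ 2)) {ε : ℝ} (hε : 0 < ε) :
    ∃ C, 0 ≤ C ∧ LinearLipschitz ε C h := by
  have hK0 : 0 ≤ K := by
    have := (abs_nonneg _).trans (hK 0)
    simpa using this
  -- Slopes at `x` and `y` are compared with secants of length `D = 1 + |x| + |y|`.
  have key : ∀ x y, x < y → |h x - h y| ≤ 7 * K * ((1 + |x| + |y|) * |x - y|) := by
    intro x y hxy
    set D := 1 + |x| + |y| with hD
    have hD1 : 1 ≤ D := by simp only [hD]; linarith [abs_nonneg x, abs_nonneg y]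
    have hsec : ∀ u v, |u| ≤ D → |v| ≤ 2 * D → |h u| + |h v| ≤ 7 * K * D * D := by
      intro u v hu hv
      have h1 := hK u
      have h2 := hK v
      have h3 : u ^ 2 ≤ D ^ 2 := by rw [← sq_abs]; gcongr
      have h4 : v ^ 2 ≤ (2 * D) ^ 2 := by rw [← sq_abs]; gcongr
      have h5 : K * (1 + u ^ 2) + K * (1 + v ^ 2) ≤ K * (7 * D * D) := by
        rw [← mul_add]
        gcongr
        nlinarith
      linarith
    have hx : |x| ≤ D := by simp only [hD]; linarith [abs_nonneg y]
    have hy : |y| ≤ D := by simp only [hD]; linarith [abs_nonneg x]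
    have hyx : 0 < y - x := by linarith
    have up := hh.slope_mono_adjacent (mem_univ x) (mem_univ (y + D)) hxy (by linarith)
    have lo := hh.slope_mono_adjacent (mem_univ (x - D)) (mem_univ y) (by linarith) hxy
    rw [add_sub_cancel_left] at up
    rw [sub_sub_cancel] at lo
    have b1 := hsec y (y + D) hy ((abs_add_le _ _).trans
      (by rw [abs_of_pos (zero_lt_one.trans_le hD1)]; linarith))
    have b2 := hsec x (x - D) hx ((abs_sub _ _).trans
      (by rw [abs_of_pos (zero_lt_one.trans_le hD1)]; linarith))
    have u1 : (h (y + D) - h y) / D ≤ 7 * K * D := by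
      rw [div_le_iff₀ (by linarith)]
      linarith [le_abs_self (h (y + D)), neg_abs_le (h y)]
    have l1 : -(7 * K * D) ≤ (h x - h (x - D)) / D := by
      rw [le_div_iff₀ (by linarith)]
      linarith [neg_abs_le (h x), le_abs_self (h (x - D))]
    have u2 := (div_le_iff₀ hyx).1 (up.trans u1)
    have l2 := (le_div_iff₀ hyx).1 (l1.trans lo)
    rw [abs_sub_comm x y, abs_of_pos hyx, abs_le]
    constructor <;> linarith
  refine ⟨7 * K * (1 + 1 / ε), by positivity, fun x y => ?_⟩
  have hall : |h x - h y| ≤ 7 * K * ((1 + |x| + |y|) * |x - y|) := by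
    rcases lt_trichotomy x y with hxy | rfl | hxy
    · exact key x y hxy
    · simp
    · have := key y x hxy
      rw [abs_sub_comm (h x), abs_sub_comm x, add_right_comm]
      exact this
  refine hall.trans ?_
  have : 1 + |x| + |y| ≤ (1 + 1 / ε) * (1 + ε * (|x| + |y|)) := by
    have e : (1 + 1 / ε) * (1 + ε * (|x| + |y|)) =
        1 + |x| + |y| + (ε * (|x| + |y|) + 1 / ε) := by
      field_simp
      ring
    rw [e]
    have : 0 ≤ ε * (|x| + |y|) + 1 / ε := by positivity
    linarith
  calc 7 * K * ((1 + |x| + |y|) * |x - y|)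
      ≤ 7 * K * ((1 + 1 / ε) * (1 + ε * (|x| + |y|)) * |x - y|) := by gcongr
    _ = _ := by ring

section uniqueTarget

variable {E : Environment} {c cost cost' z z' : ℝ} {h h' : ℝ → ℝ} {ψ : Measure ℝ}
  [IsProbabilityMeasure ψ]

theorem LinearLipschitz.sub {ε C C' : ℝ} {f f' : ℝ → ℝ} (hf : LinearLipschitz ε C f)
    (hf' : LinearLipschitz ε C' f') : LinearLipschitz ε (C + C') fun x => f x - f' x := by
  intro x y
  have h1 := hf x y
  have h2 := hf' x y
  have h3 := abs_sub (f x - f y) (f' x - f' y)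
  rw [show f x - f' x - (f y - f' y) = f x - f y - (f' x - f' y) by ring]
  linarith

/-- The difference of two relative value functions with the same cost is subharmonic for the rule
that is optimal for the second one, hence bounded by its stationary mean. -/
theorem IsRelativeValue.sub_le_integral (hE : E.MeanSquareStable)
    (H : IsRelativeValue E c cost h) (hz : ∀ y, (z - c) ^ 2 + h z ≤ (y - c) ^ 2 + h y)
    (H' : IsRelativeValue E c cost h') (hz' : ∀ y, (z' - c) ^ 2 + h' z' ≤ (y - c) ^ 2 + h' y)
    (hψ : AnchorInvariant E z ψ) (h2 : MemLp id 2 ψ) (x : ℝ) :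
    h' x - h x ≤ ∫ y, (h' y - h y) ∂ψ := by
  obtain ⟨ε, r, hε, hr0, hr1, hr⟩ := hE.exists_weight
  obtain ⟨K, hK⟩ := H.growth
  obtain ⟨K', hK'⟩ := H'.growth
  obtain ⟨C, hC, hl⟩ := exists_linearLipschitz_of_convexOn H.convex hK hε
  obtain ⟨C', hC', hl'⟩ := exists_linearLipschitz_of_convexOn H'.convex hK' hε
  set f : ℝ → ℝ := fun x => h' x - h x with hf
  have hfl : LinearLipschitz ε (C' + C) f := hl'.sub hl
  have hCC : 0 ≤ C' + C := add_nonneg hC' hC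
  obtain ⟨G, hG⟩ := H.growth_total
  obtain ⟨G', hG'⟩ := H'.growth_total
  have hsubh : ∀ x, f x ≤ transition E z f x := by
    intro x
    have i1 := integrable_comp_of_quadratic_growth (hE.memLp_anchor z x) H.continuous_total hG
    have i2 := integrable_comp_of_quadratic_growth (hE.memLp_anchor z x) H'.continuous_total hG'
    have i3 := integrable_comp_of_quadratic_growth (hE.memLp_anchor z' x) H'.continuous_total hG'
    have e1 := H.bellman hz x
    have e2 := H'.bellman hz' x
    have e3 : ∫ e : Shock, ((anchor z' e x - c) ^ 2 + h' (anchor z' e x)) ∂E.law ≤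
        ∫ e : Shock, ((anchor z e x - c) ^ 2 + h' (anchor z e x)) ∂E.law := by
      refine integral_mono_ae i3 i2 ?_
      filter_upwards [E.ae_interval_le] with e he
      exact apply_proj_le (strictConvexOn_sq_sub_add c H'.convex).convexOn hz'
        (proj_mem (he x) z)
    have e4 : transition E z f x =
        ∫ e : Shock, ((anchor z e x - c) ^ 2 + h' (anchor z e x)) ∂E.law -
        ∫ e : Shock, ((anchor z e x - c) ^ 2 + h (anchor z e x)) ∂E.law := by
      rw [← integral_sub i2 i1]
      refine integral_congr_ae (Eventually.of_forall fun e => ?_)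
      simp only [hf]
      ring
    rw [e4]
    simp only [hf]
    linarith
  have hiter : ∀ n x, f x ≤ (transition E z)^[n] f x := by
    intro n
    induction n with
    | zero => exact fun x => le_rfl
    | succ n ih =>
      intro x
      rw [Function.iterate_succ_apply']
      refine (hsubh x).trans (integral_mono (hfl.integrable_anchor hE hε hCC z x) ?_
        fun e => ih _)
      exact (hfl.iterate_transition hE hε hr0 hr hCC z n).integrable_anchor hE hε
        (by positivity) z x
  exact ge_of_tendsto (hψ.tendsto_iterate_transition hE h2 hε hCC hfl hr0 hr1 hr x)
    (Eventually.of_forall fun n => hiter n x)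

/-- Two unconstrained minimizers for the same center coincide as soon as their anchoring rules share
a stationary law: the relative value functions then differ by a constant. -/
theorem IsRelativeValue.target_unique (hE : E.MeanSquareStable)
    (H : IsRelativeValue E c cost h) (hz : ∀ y, (z - c) ^ 2 + h z ≤ (y - c) ^ 2 + h y)
    (H' : IsRelativeValue E c cost' h') (hz' : ∀ y, (z' - c) ^ 2 + h' z' ≤ (y - c) ^ 2 + h' y)
    (hψ : AnchorInvariant E z ψ) (hψ' : AnchorInvariant E z' ψ) (h2 : MemLp id 2 ψ) :
    z' = z := by
  have hcost : cost' = cost :=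
    (hψ'.integral_sq_sub_eq_cost hE h2 H' hz').symm.trans (hψ.integral_sq_sub_eq_cost hE h2 H hz)
  subst hcost
  have hle := H.sub_le_integral hE hz H' hz' hψ h2
  have hge := H'.sub_le_integral hE hz' H hz hψ' h2
  have hneg : ∫ y, (h y - h' y) ∂ψ = -∫ y, (h' y - h y) ∂ψ := by
    rw [← integral_neg]
    congr 1
    ext y
    ring
  have hconst : ∀ x, h' x = h x + ∫ y, (h' y - h y) ∂ψ := fun x => by
    have h1 := hle x
    have h3 := hge x
    rw [hneg] at h3
    linarith
  refine (strictConvexOn_sq_sub_add c H.convex).eq_of_isMinOn (fun y _ => ?_) (fun y _ => hz y)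
    (mem_univ _) (mem_univ _)
  have := hz' y
  rw [hconst z', hconst y] at this
  change (z' - c) ^ 2 + h z' ≤ (y - c) ^ 2 + h y
  linarith

end uniqueTarget

section uniqueCenter

variable {E : Environment}

theorem eq_of_proj_mem_Ioo {I : ℝ × ℝ} {z : ℝ} (h : proj I z ∈ Ioo I.1 I.2) : proj I z = z := by
  have hI : I.1 ≤ I.2 := (h.1.trans h.2).le
  rcases le_total z I.1 with h1 | h1
  · exact absurd (proj_eq_left hI h1) h.1.ne'
  · rcases le_total I.2 z with h2 | h2
    · exact absurd (proj_eq_right hI h2) h.2.ne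
    · exact proj_eq_self h1 h2

/-- If two actions that differ by `d ≠ 0` admit next actions that differ by `d` as well, and
`A ≠ 1`, then the midpoint of the next actions is interior to the interval that follows the midpoint
of the actions. -/
theorem midpoint_mem_Ioo {e : Shock} (hA : e.A ≠ 1) {x d p : ℝ} (hd : d ≠ 0)
    (h1 : p ∈ Icc (e.interval x).1 (e.interval x).2)
    (h2 : p - d ∈ Icc (e.interval (x - d)).1 (e.interval (x - d)).2) :
    p - d / 2 ∈ Ioo (e.interval (x - d / 2)).1 (e.interval (x - d / 2)).2 := by
  unfold Shock.interval at *
  simp only [mem_Icc, mem_Ioo] at *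
  have hne : d ≠ e.A * d := fun h => hA (by
    have : (1 - e.A) * d = 0 := by linarith
    rcases mul_eq_zero.1 this with h0 | h0
    · linarith
    · exact absurd h0 hd)
  obtain ⟨a1, a2⟩ := h1
  obtain ⟨b1, b2⟩ := h2
  constructor
  · refine lt_of_le_of_ne (by linarith) fun h => hne (by linarith)
  · refine lt_of_le_of_ne (by linarith) fun h => hne (by linarith)

/-- In a non-degenerate environment the means of two optimal anchoring rules agree. Driven by the
same shocks from a joint infinite past, the midpoint of the two paths is feasible, and it is optimal
only if the two paths differ by a constant. -/
theorem Environment.MeanSquareStable.center_unique (hE : E.MeanSquareStable)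
    (hnd : E.Nondegenerate) {z₁ z₂ c₁ c₂ v cost z : ℝ} {h : ℝ → ℝ}
    (h₁ : ∫ x, (x - c₁) ^ 2 ∂stationaryLaw E z₁ = v)
    (h₂ : ∫ x, (x - c₂) ^ 2 ∂stationaryLaw E z₂ = v)
    (H : IsRelativeValue E ((c₁ + c₂) / 2) cost h)
    (hz : ∀ y, (z - (c₁ + c₂) / 2) ^ 2 + h z ≤ (y - (c₁ + c₂) / 2) ^ 2 + h y)
    (hv : v ≤ cost) : c₁ = c₂ := by
  set Q := E.streamLaw with hQ
  set X := stationaryAction z₁ with hX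
  set Y := stationaryAction z₂ with hY
  have hXm : Measurable X := measurable_stationaryAction z₁
  have hYm : Measurable Y := measurable_stationaryAction z₂
  have hXL : MemLp X 2 Q := hE.memLp_stationaryAction z₁
  have hYL : MemLp Y 2 Q := hE.memLp_stationaryAction z₂
  set M : ShockStream → ℝ := fun ω => (X ω + Y ω) / 2 with hM
  have hMm : Measurable M := (hXm.add hYm).div_const 2
  have hML : MemLp M 2 Q := by
    have : M = fun ω => (1 / 2 : ℝ) * (X ω + Y ω) := by
      ext ω; simp only [hM]; ring
    rw [this]
    exact (hXL.add hYL).const_mul _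
  have hpush := measurePreserving_push E
  have hXp := hE.ae_stationaryAction_push z₁
  have hYp := hE.ae_stationaryAction_push z₂
  have hUV := E.ae_prod_base_nonempty Q
  have S : FeasibleStep E (Q.prod E.law) (fun q => M q.1) (fun q => q.2.interval (M q.1))
      (fun q => M (ShockStream.push q)) := by
    refine FeasibleStep.of_prod E hMm (hMm.comp measurable_push) ?_
    filter_upwards [hXp, hYp, hUV] with q h1 h2 hq
    have p1 := proj_mem (interval_fst_le_snd hq (X q.1)) z₁
    have p2 := proj_mem (interval_fst_le_snd hq (Y q.1)) z₂
    simp only [hM, hX, hY] at *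
    rw [h1, h2]
    unfold anchor Shock.interval at *
    simp only [mem_Icc] at *
    constructor <;> linarith [p1.1, p1.2, p2.1, p2.2]
  have hML' : MemLp (fun q : ShockStream × Shock => M q.1) 2 (Q.prod E.law) :=
    hML.comp_fst E.law
  have hmap : (Q.prod E.law).map (fun q => M (ShockStream.push q)) =
      (Q.prod E.law).map fun q => M q.1 := by
    have e1 : (Q.prod E.law).map (fun q => M (ShockStream.push q)) = Q.map M := by
      conv_rhs => rw [hQ, ← hpush.map_eq, Measure.map_map hMm measurable_push]
      rfl
    have e2 : (Q.prod E.law).map (fun q => M q.1) = Q.map M := by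
      rw [show (fun q : ShockStream × Shock => M q.1) = M ∘ Prod.fst from rfl,
        ← Measure.map_map hMm measurable_fst, Measure.map_fst_prod]
      simp
    rw [e1, e2]
  have hfst : ∫ q, (M q.1 - (c₁ + c₂) / 2) ^ 2 ∂Q.prod E.law =
      ∫ ω, (M ω - (c₁ + c₂) / 2) ^ 2 ∂Q := by
    rw [integral_fun_fst (fun ω => (M ω - (c₁ + c₂) / 2) ^ 2)]
    simp
  have hlow := S.cost_le_of_map_eq hE hML' H hz hmap
  rw [hfst] at hlow
  have i1 := integrable_sq_sub hXL c₁
  have i2 := integrable_sq_sub hYL c₂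
  have i3 : Integrable (fun ω => (X ω - Y ω - (c₁ - c₂)) ^ 2) Q :=
    integrable_sq_sub (hXL.sub hYL) (c₁ - c₂)
  rw [stationaryLaw, integral_map hXm.aemeasurable
    (Measurable.aestronglyMeasurable (by fun_prop))] at h₁
  rw [stationaryLaw, integral_map hYm.aemeasurable
    (Measurable.aestronglyMeasurable (by fun_prop))] at h₂
  have hpar : ∫ ω, (M ω - (c₁ + c₂) / 2) ^ 2 ∂Q =
      v - 1 / 4 * ∫ ω, (X ω - Y ω - (c₁ - c₂)) ^ 2 ∂Q := by
    calc ∫ ω, (M ω - (c₁ + c₂) / 2) ^ 2 ∂Q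
        = ∫ ω, (1 / 2 * (X ω - c₁) ^ 2 + (1 / 2 * (Y ω - c₂) ^ 2 +
            -(1 / 4) * (X ω - Y ω - (c₁ - c₂)) ^ 2)) ∂Q := by
          congr 1; ext ω; simp only [hM]; ring
      _ = 1 / 2 * v + (1 / 2 * v + -(1 / 4) * ∫ ω, (X ω - Y ω - (c₁ - c₂)) ^ 2 ∂Q) := by
          have i4 : Integrable (fun ω => 1 / 2 * (Y ω - c₂) ^ 2 +
              -(1 / 4) * (X ω - Y ω - (c₁ - c₂)) ^ 2) Q :=
            (i2.const_mul _).add (i3.const_mul _)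
          rw [integral_add (i1.const_mul _) i4,
            integral_add (i2.const_mul _) (i3.const_mul _), integral_const_mul,
            integral_const_mul, integral_const_mul, h₁, h₂]
      _ = _ := by ring
  have hnn : 0 ≤ ∫ ω, (X ω - Y ω - (c₁ - c₂)) ^ 2 ∂Q := integral_nonneg fun ω => sq_nonneg _
  have hzero : ∫ ω, (X ω - Y ω - (c₁ - c₂)) ^ 2 ∂Q = 0 := by linarith
  have hdiff : ∀ᵐ ω ∂Q, X ω - Y ω = c₁ - c₂ := by
    filter_upwards [(integral_eq_zero_iff_of_nonneg (fun ω => sq_nonneg _) i3).1 hzero] with ω hω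
    have := pow_eq_zero_iff (two_ne_zero) |>.1 hω
    linarith
  have hproj := S.ae_eq_proj_of_map_eq hE hML' H hz hmap (by rw [hfst]; linarith)
  by_contra hne
  have hd : c₁ - c₂ ≠ 0 := sub_ne_zero.2 hne
  -- A shock with `A ≠ 1` leads the midpoint path to `z`, through an interval around `z`.
  have hint : ∀ᵐ q ∂Q.prod E.law, q.2.A ≠ 1 →
      M (ShockStream.push q) = z ∧ z ∈ Ioo (q.2.interval (M q.1)).1 (q.2.interval (M q.1)).2 := by
    filter_upwards [hXp, hYp, hUV, hproj,
      Measure.quasiMeasurePreserving_fst.ae hdiff, hpush.quasiMeasurePreserving.ae hdiff]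
      with q h1 h2 hq hpr hd1 hd2 hA
    have p1 := proj_mem (interval_fst_le_snd hq (X q.1)) z₁
    have p2 := proj_mem (interval_fst_le_snd hq (Y q.1)) z₂
    change anchor z₁ q.2 (X q.1) ∈ _ at p1
    change anchor z₂ q.2 (Y q.1) ∈ _ at p2
    rw [← h1] at p1
    rw [← h2] at p2
    have eY : Y q.1 = X q.1 - (c₁ - c₂) := by linarith
    have eY' : Y (ShockStream.push q) = X (ShockStream.push q) - (c₁ - c₂) := by linarith
    change Y (ShockStream.push q) ∈ _ at p2
    rw [eY', eY] at p2
    have hmid := midpoint_mem_Ioo hA hd p1 p2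
    have eM : X q.1 - (c₁ - c₂) / 2 = M q.1 := by simp only [hM]; linarith
    have eM' : X (ShockStream.push q) - (c₁ - c₂) / 2 = M (ShockStream.push q) := by
      simp only [hM]; linarith
    change X (ShockStream.push q) - (c₁ - c₂) / 2 ∈ _ at hmid
    rw [eM, eM', hpr] at hmid
    have hz' := eq_of_proj_mem_Ioo hmid
    rw [hz'] at hmid
    exact ⟨hpr.trans hz', hmid⟩
  set N : Set Shock := {e | e.A ≠ 1 ∧ ¬ ((e.interval z).1 < z ∧ z < (e.interval z).2)} with hN
  have hNpos : 0 < E.law N := hnd z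
  -- Hence `z` is an atom of the midpoint law.
  have hatom : 0 < Q {ω | M ω = z} := by
    have hms : MeasurableSet {ω | M ω = z} := hMm (measurableSet_singleton z)
    rw [hQ, ← hpush.measure_preimage hms.nullMeasurableSet]
    have hle : (Q.prod E.law) (univ ×ˢ N) ≤
        (Q.prod E.law) (ShockStream.push ⁻¹' {ω | M ω = z}) := by
      refine measure_mono_ae ?_
      filter_upwards [hint] with q hq hmem
      exact (hq hmem.2.1).1
    rw [Measure.prod_prod, measure_univ, one_mul] at hle
    exact hNpos.trans_le hle
  have hnull : (Q.prod E.law) ({ω | M ω = z} ×ˢ N) = 0 := by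
    refine measure_mono_null ?_ (ae_iff.1 hint)
    rintro q ⟨hq1, hq2⟩ hcon
    obtain ⟨-, hz'⟩ := hcon hq2.1
    have : M q.1 = z := hq1
    rw [this] at hz'
    exact hq2.2 hz'
  rw [Measure.prod_prod] at hnull
  exact (ENNReal.mul_pos hatom.ne' hNpos.ne').ne' hnull

end uniqueCenter

/-! ### Optimal center and the reflection example -/

section optimality

variable {E : Environment}

theorem memLp_two_of_evariance_ne_top {ψ : Measure ℝ} [IsProbabilityMeasure ψ]
    (h : evariance id ψ ≠ ∞) : MemLp id 2 ψ := by
  by_contra hcon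
  exact h (evariance_eq_top (by fun_prop) hcon)

/-- The optimal average cost has a minimizing center, and that center is the mean of the stationary
law of the corresponding anchoring rule. -/
theorem exists_optimal_center (hE : E.MeanSquareStable) {cost z : ℝ → ℝ} {h : ℝ → ℝ → ℝ}
    (H : ∀ c, IsRelativeValue E c (cost c) (h c))
    (hz : ∀ c y, (z c - c) ^ 2 + h c (z c) ≤ (y - c) ^ 2 + h c y) :
    ∃ c₀, (∀ c, cost c₀ ≤ cost c) ∧ ∫ x, x ∂stationaryLaw E (z c₀) = c₀ := by
  have hinv : ∀ c, AnchorInvariant E (z c) (stationaryLaw E (z c)) := fun c =>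
    hE.anchorInvariant_stationaryLaw _
  have hL : ∀ c, MemLp id 2 (stationaryLaw E (z c)) := fun c => hE.memLp_stationaryLaw _
  have hcost : ∀ c, ∫ x, (x - c) ^ 2 ∂stationaryLaw E (z c) = cost c := fun c =>
    (hinv c).integral_sq_sub_eq_cost hE (hL c) (H c) (hz c)
  have hle : ∀ c c', cost c ≤ ∫ x, (x - c) ^ 2 ∂stationaryLaw E (z c') := fun c c' =>
    (hinv c').isStationary.cost_le hE (hL c') (H c) (hz c)
  obtain ⟨a, C, ha0, ha1, hC, haC⟩ := hE.exists_sq_drift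
  have hs : ∀ c, ∫ x, x ^ 2 ∂stationaryLaw E (z c) ≤ C / (1 - a) := fun c =>
    (hinv c).integral_sq_le hE (hL c) ha0 ha1 hC haC
  have hR : 0 ≤ C / (1 - a) := div_nonneg hC (by linarith)
  obtain ⟨c₀, hc₀⟩ := exists_forall_le_of_moment_family (f := cost)
    (s := fun c => ∫ x, x ^ 2 ∂stationaryLaw E (z c))
    (m := fun c => ∫ x, x ∂stationaryLaw E (z c)) (R := C / (1 - a) + 1)
    (fun c => integral_nonneg fun x => sq_nonneg x) (fun c => by linarith [hs c])
    (fun c => by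
      have h1 : 0 ≤ ∫ x, (x - ∫ y, y ∂stationaryLaw E (z c)) ^ 2 ∂stationaryLaw E (z c) :=
        integral_nonneg fun x => sq_nonneg _
      rw [integral_sq_sub (hL c)] at h1
      refine abs_le_of_sq_le_sq ?_ (by linarith)
      nlinarith [hs c])
    (fun c c' => by rw [← integral_sq_sub (hL c')]; exact hle c c')
    (fun c => by rw [← integral_sq_sub (hL c)]; exact (hcost c).symm)
  refine ⟨c₀, hc₀, ?_⟩
  set m := ∫ x, x ∂stationaryLaw E (z c₀) with hm
  have h1 := integral_sq_sub_eq_add (hL c₀) c₀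
  rw [hcost c₀, ← hm] at h1
  have h2 := hle m c₀
  have h3 := hc₀ m
  have h4 : (m - c₀) ^ 2 = 0 := le_antisymm (by linarith) (sq_nonneg _)
  have := pow_eq_zero_iff two_ne_zero |>.1 h4
  linarith

theorem exists_optimalTarget (hE : E.MeanSquareStable) :
    ∃ (z : ℝ) (ψ : Measure ℝ),
      IsOptimalTarget E z ψ ∧
      MemLp id 2 ψ ∧
      (∀ ψ' : Measure ℝ, IsStationary E (anchoring z) ψ' → ψ' = ψ) ∧
      (∀ ρ : Measure ℝ, IsProbabilityMeasure ρ → MemLp id 2 ρ →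
        longRunVariance E (anchoring z) ρ = evariance id ψ ∧
        ∀ π : Policy, Admissible E π ρ → evariance id ψ ≤ longRunVariance E π ρ) ∧
      (E.Nondegenerate →
        (∀ (π : Policy) (ψ' : Measure ℝ), MinimizesStationaryVariance E π ψ' →
          ψ' = ψ ∧ ∀ t : ℕ, ∀ᵐ x ∂pathLaw E π ψ', (x (t + 1)).2 = proj (x (t + 1)).1 z) ∧
        ∀ (z' : ℝ) (ψ' : Measure ℝ), IsOptimalTarget E z' ψ' → z' = z) := by
  choose cost h z H hz using exists_isRelativeValue hE
  obtain ⟨c₀, hmin, hmean⟩ := exists_optimal_center hE H hz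
  have hinv := hE.anchorInvariant_stationaryLaw (z c₀)
  have hL := hE.memLp_stationaryLaw (z c₀)
  have hcost : ∀ c, ∫ x, (x - c) ^ 2 ∂stationaryLaw E (z c) = cost c := fun c =>
    (hE.anchorInvariant_stationaryLaw _).integral_sq_sub_eq_cost hE (hE.memLp_stationaryLaw _)
      (H c) (hz c)
  have hevar : evariance id (stationaryLaw E (z c₀)) = ENNReal.ofReal (cost c₀) := by
    rw [evariance_id_eq hL, hmean, hcost]
  have hcost0 : 0 ≤ cost c₀ := by
    rw [← hcost]; exact integral_nonneg fun x => sq_nonneg _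
  have hMSV : MinimizesStationaryVariance E (anchoring (z c₀)) (stationaryLaw E (z c₀)) := by
    refine ⟨hinv.isStationary, fun π' ψ' Hψ' => ?_⟩
    have := Hψ'.isProb
    by_cases hL' : MemLp id 2 ψ'
    · rw [hevar, evariance_id_eq hL']
      exact ENNReal.ofReal_le_ofReal ((hmin _).trans (Hψ'.cost_le hE hL' (H _) (hz _)))
    · rw [evariance_eq_top (by fun_prop) hL']
      exact le_top
  have huniq : ∀ ψ' : Measure ℝ, IsStationary E (anchoring (z c₀)) ψ' →
      ψ' = stationaryLaw E (z c₀) := fun ψ' Hψ' => by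
    have := Hψ'.isProb
    exact (isStationary_anchoring_iff.1 Hψ').eq_stationaryLaw hE
  refine ⟨z c₀, stationaryLaw E (z c₀), ⟨hMSV, ?_⟩, hL, huniq, fun ρ hρ hρ2 => ?_, fun hnd => ?_⟩
  · rw [hmean]
    exact ⟨cost c₀, h c₀, H c₀, hz c₀⟩
  · have hlow : ∀ π : Policy, Admissible E π ρ →
        evariance id (stationaryLaw E (z c₀)) ≤ longRunVariance E π ρ := fun π hadm => by
      rw [hevar]
      exact le_iInf fun c => (ENNReal.ofReal_le_ofReal (hmin c)).trans
        (hadm.cost_le_longRunMSE hE hρ2 (H c) (hz c))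
    refine ⟨le_antisymm ?_ (hlow _ (admissible_anchoring E ρ _)), hlow⟩
    rw [hevar]
    exact (iInf_le _ c₀).trans (longRunMSE_anchoring_le hE hρ2 (H c₀) (hz c₀))
  · have hpol : ∀ (π : Policy) (ψ' : Measure ℝ), MinimizesStationaryVariance E π ψ' →
        ψ' = stationaryLaw E (z c₀) ∧
          ∀ t : ℕ, ∀ᵐ x ∂pathLaw E π ψ', (x (t + 1)).2 = proj (x (t + 1)).1 (z c₀) := by
      intro π ψ' Hψ'
      have := Hψ'.1.isProb
      have hle := Hψ'.2 _ _ hMSV.1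
      rw [hevar] at hle
      have hL' : MemLp id 2 ψ' :=
        memLp_two_of_evariance_ne_top (ne_top_of_le_ne_top ENNReal.ofReal_ne_top hle)
      rw [evariance_id_eq hL', ENNReal.ofReal_le_ofReal_iff hcost0] at hle
      set c' := ∫ y, y ∂ψ' with hc'
      have hproj := Hψ'.1.ae_eq_proj hE hL' (H c') (hz c') (hle.trans (hmin c'))
      have hψ' : ψ' = stationaryLaw E (z c') :=
        (Hψ'.1.anchorInvariant (hproj 0)).eq_stationaryLaw hE
      have h1 : ∫ x, (x - c') ^ 2 ∂stationaryLaw E (z c') = cost c₀ := by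
        refine le_antisymm (hψ' ▸ hle) ?_
        rw [hcost]
        exact hmin c'
      have hcc : c' = c₀ := hE.center_unique hnd h1 (hcost c₀) (H _) (hz _) (hmin _)
      rw [hcc] at hψ' hproj
      exact ⟨hψ', hproj⟩
    refine ⟨hpol, fun z' ψ' Hz' => ?_⟩
    have hψ' := (hpol _ _ Hz'.1).1
    subst hψ'
    obtain ⟨cost', h', H', hz'⟩ := Hz'.2
    rw [hmean] at H' hz'
    exact (H c₀).target_unique hE (hz c₀) H' hz' hinv (isStationary_anchoring_iff.1 Hz'.1.1) hL

end optimality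

section reflectionExample

/-- With probability `1/3` each: every action in `[-2, 2]` is feasible; the action is forced to `1`;
the action is forced to the negative of the previous one. -/
def reflectionLaw : Measure Shock :=
  (3⁻¹ : ℝ≥0∞) • (Measure.dirac (0, 0, -2, 2) + Measure.dirac (0, 1, 0, 0) +
    Measure.dirac (-1, 0, 0, 0))

instance : IsProbabilityMeasure reflectionLaw := ⟨by
  simp only [reflectionLaw, Measure.smul_apply, Measure.add_apply, measure_univ, smul_eq_mul]
  rw [one_add_one_eq_two, two_add_one_eq_three]
  exact ENNReal.inv_mul_cancel (by norm_num) (by norm_num)⟩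

theorem ae_reflectionLaw {p : Shock → Prop} (h1 : p (0, 0, -2, 2)) (h2 : p (0, 1, 0, 0))
    (h3 : p (-1, 0, 0, 0)) : ∀ᵐ e ∂reflectionLaw, p e := by
  refine Measure.ae_smul_measure ?_ _
  rw [ae_add_measure_iff, ae_add_measure_iff]
  simp only [ae_dirac_eq]
  exact ⟨⟨h1, h2⟩, h3⟩

/-- The environment with shock law `reflectionLaw`. Forcing the action to `1` makes it
non-degenerate; the reflection makes the future constraints depend on the current action. -/
def reflectionEnv : Environment where
  law := reflectionLaw
  isProb := inferInstance
  base_nonempty := ae_reflectionLaw (by norm_num) (by norm_num) (by norm_num)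

theorem integrable_reflection (f : Shock → ℝ) : Integrable f reflectionEnv.law := by
  refine Integrable.smul_measure ?_ (by norm_num)
  exact ((integrable_dirac (by simp)).add_measure (integrable_dirac (by simp))).add_measure
    (integrable_dirac (by simp))

theorem integral_reflection (f : Shock → ℝ) : ∫ e, f e ∂reflectionEnv.law =
    (f (0, 0, -2, 2) + f (0, 1, 0, 0) + f (-1, 0, 0, 0)) / 3 := by
  have h1 : ∀ a : Shock, Integrable f (Measure.dirac a) := fun a => integrable_dirac (by simp)
  change ∫ e, f e ∂reflectionLaw = _
  rw [reflectionLaw, integral_smul_measure, integral_add_measure ((h1 _).add_measure (h1 _)) (h1 _),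
    integral_add_measure (h1 _) (h1 _), integral_dirac, integral_dirac, integral_dirac]
  simp
  ring

theorem stable_reflectionEnv : reflectionEnv.Stable 2 where
  two_le := le_rfl
  integrable_A := integrable_reflection _
  integral_A_lt_one := by
    rw [integral_reflection]
    norm_num
  integrable_B := integrable_reflection _
  integrable_U := integrable_reflection _
  integrable_V := integrable_reflection _

theorem reflectionLaw_pos {s : Set Shock} {a : Shock} (ha : a = (0, 1, 0, 0) ∨ a = (-1, 0, 0, 0))
    (h : a ∈ s) : 0 < reflectionEnv.law s := by
  rw [pos_iff_ne_zero]
  intro h0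
  change reflectionLaw s = 0 at h0
  simp only [reflectionLaw, Measure.smul_apply, Measure.add_apply, smul_eq_mul, mul_eq_zero,
    add_eq_zero, ENNReal.inv_eq_zero, ENNReal.ofNat_ne_top, false_or] at h0
  rcases ha with rfl | rfl
  · have := h0.1.2
    rw [Measure.dirac_apply_of_mem h] at this
    exact one_ne_zero this
  · have := h0.2
    rw [Measure.dirac_apply_of_mem h] at this
    exact one_ne_zero this

theorem nondegenerate_reflectionEnv : reflectionEnv.Nondegenerate := fun z => by
  refine reflectionLaw_pos (Or.inl rfl) ⟨by simp [Shock.A], ?_⟩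
  unfold Shock.interval
  simp only
  rintro ⟨h1, h2⟩
  linarith

theorem not_ae_A_eq_zero_reflectionEnv : ¬ ∀ᵐ e ∂reflectionEnv.law, e.A = 0 := fun h =>
  (reflectionLaw_pos (s := {e | ¬ e.A = 0}) (Or.inr rfl) (by simp [Shock.A])).ne' (ae_iff.1 h)

theorem transition_reflection (z : ℝ) (f : ℝ → ℝ) (x : ℝ) :
    transition reflectionEnv z f x = (f (proj (-2, 2) z) + f 1 + f (-x)) / 3 := by
  have h2 : anchor z (0, 1, 0, 0) x = 1 := by
    simp [anchor, proj, Shock.interval, Shock.A, Shock.B, Shock.U, Shock.V]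
  have h3 : anchor z (-1, 0, 0, 0) x = -x := by
    simp [anchor, proj, Shock.interval, Shock.A, Shock.B, Shock.U, Shock.V]
  have h1 : anchor z (0, 0, -2, 2) x = proj (-2, 2) z := by
    simp [anchor, proj, Shock.interval, Shock.A, Shock.B, Shock.U, Shock.V]
  rw [transition, integral_reflection, h1, h2, h3]

theorem reflection_moments {z : ℝ} {ψ : Measure ℝ} [IsProbabilityMeasure ψ]
    (hψ : AnchorInvariant reflectionEnv z ψ) (h2 : MemLp id 2 ψ) :
    ∫ x, x ∂ψ = (proj (-2, 2) z + 1) / 4 ∧ ∫ x, x ^ 2 ∂ψ = (proj (-2, 2) z ^ 2 + 1) / 2 := by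
  have i1 : Integrable (fun x : ℝ => x) ψ := h2.integrable one_le_two
  have i2 : Integrable (fun x : ℝ => x ^ 2) ψ := h2.integrable_sq
  have i3 : Integrable (fun x : ℝ => -x) ψ := i1.neg
  have e1 := (hψ.integral_transition measurable_id i1).2
  have e2 := (hψ.integral_transition (measurable_id.pow_const 2) i2).2
  simp only [transition_reflection, id] at e1 e2
  rw [integral_div, integral_add (integrable_const _) i3, integral_neg] at e1
  simp only [neg_sq] at e2
  rw [integral_div, integral_add (integrable_const _) i2] at e2
  simp only [integral_const, probReal_univ, one_smul] at e1 e2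
  constructor <;> linarith

/-- The variance of a target equal to its stationary mean is `4/9`, that of the target `0` is
`7/16`. -/
theorem reflection_target_ne_mean {z : ℝ} {ψ : Measure ℝ}
    (h : MinimizesStationaryVariance reflectionEnv (anchoring z) ψ) : z ≠ ∫ x, x ∂ψ := by
  have hE := stable_reflectionEnv.meanSquareStable
  have := h.1.isProb
  have hinv := isStationary_anchoring_iff.1 h.1
  have hψ := hinv.eq_stationaryLaw hE
  have hL : MemLp id 2 ψ := hψ ▸ hE.memLp_stationaryLaw z
  have hinv0 := hE.anchorInvariant_stationaryLaw 0
  have hL0 := hE.memLp_stationaryLaw 0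
  have hle := h.2 _ _ hinv0.isStationary
  rw [evariance_id_eq hL, evariance_id_eq hL0,
    ENNReal.ofReal_le_ofReal_iff (integral_nonneg fun x => sq_nonneg _),
    integral_sq_sub hL, integral_sq_sub hL0] at hle
  obtain ⟨m1, s1⟩ := reflection_moments hinv hL
  obtain ⟨m0, s0⟩ := reflection_moments hinv0 hL0
  have hp0 : proj (-2, 2) 0 = 0 := proj_eq_self (by norm_num) (by norm_num)
  rw [hp0] at m0 s0
  rw [m1, s1, m0, s0] at hle
  rw [m1]
  intro hz
  have hmem := proj_mem (I := (-2, 2)) (by norm_num) z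
  obtain ⟨b1, b2⟩ := hmem
  simp only at b1 b2
  have hpz : proj (-2, 2) z = z := proj_eq_self (by simp only; linarith) (by simp only; linarith)
  rw [hpz] at hle hz
  have : z = 1 / 3 := by linarith
  subst this
  norm_num at hle

end reflectionExample

end

end FeasibleInterval

open FeasibleInterval in
theorem theorem4 :
    (∀ (E : Environment) (p : ℝ), E.Stable p →
      ∃ (z : ℝ) (ψ : Measure ℝ),
        -- the anchoring rule at `z` is optimal, in the stationary and in the long-run average sense
        IsOptimalTarget E z ψ ∧
        MemLp id 2 ψ ∧
        (∀ ψ' : Measure ℝ, IsStationary E (anchoring z) ψ' → ψ' = ψ) ∧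
        (∀ ρ : Measure ℝ, IsProbabilityMeasure ρ → MemLp id 2 ρ →
          longRunVariance E (anchoring z) ρ = evariance id ψ ∧
          ∀ π : Policy, Admissible E π ρ → evariance id ψ ≤ longRunVariance E π ρ) ∧
        -- uniqueness of the optimal policy and of the optimal target
        (E.Nondegenerate →
          (∀ (π : Policy) (ψ' : Measure ℝ), MinimizesStationaryVariance E π ψ' →
            ψ' = ψ ∧ ∀ t : ℕ, ∀ᵐ x ∂pathLaw E π ψ', (x (t + 1)).2 = proj (x (t + 1)).1 z) ∧
          ∀ (z' : ℝ) (ψ' : Measure ℝ), IsOptimalTarget E z' ψ' → z' = z)) ∧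
    -- when the constraints are endogenous, the target need not be the stationary mean
    (∃ (E : Environment) (p : ℝ), E.Stable p ∧ E.Nondegenerate ∧ ¬ (∀ᵐ e ∂E.law, e.A = 0) ∧
      ∀ (z : ℝ) (ψ : Measure ℝ), MinimizesStationaryVariance E (anchoring z) ψ →
        z ≠ ∫ x, x ∂ψ) :=
  ⟨fun _ _ hE => exists_optimalTarget hE.meanSquareStable,
    reflectionEnv, 2, stable_reflectionEnv, nondegenerate_reflectionEnv,
    not_ae_A_eq_zero_reflectionEnv, fun _ _ h => reflection_target_ne_mean h⟩
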